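/- Let $F:\{-1,1\}^n\to\{-1,1\}$ be a symmetric function (invariant under permuting its inputs), and for $0\le i\le n$ let $D_F(i)$ be the value of $F$ on inputs with exactly $i$ coordinates equal to $-1$. Let $\deg_{oe}(F)$ be the number of $i\in\{0,1,\dots,n-2\}$ with $D_F(i)\ne D_F(i+2)$. Let $r(F)$ be the least value of $\max\{r_0,r_1\}$ over integers $0\le r_0,r_1\le\lceil n/2\rceil$ such that $D_F(i)=D_F(i+2)$ for all integers $i\in[r_0,n-r_1)$ with $i+2\le n$. For a real multilinear polynomial $p(x)=\sum_{S\subseteq[n]}c_S\prod_{i\in S}x_i$ put $wt(p)=\sum_S|c_S|$, and say that $p$ sign represents $F$ if $p(x)F(x)>0$ for all $x\in\{-1,1\}^n$. Let $wt_{1/3}(F)$ be the infimum of $wt(p)$ over all $p$ with $|p(x)-F(x)|<1/3$ for all $x\in\{-1,1\}^n$. Let $\mathrm{mon}_\pm(F)$ be the least number of monomials (nonzero coefficients) of a $p$ that sign represents $F$. Let $m(F)$ be the maximum of $\min_{x\in\{-1,1\}^n}p(x)F(x)$ over all $p$ with $wt(p)\le1$ that sign represent $F$. Logarithms are to base $2$.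 There are universal constants $c_1,c_2,c_3>0$ such that for every $n$ and every symmetric $F:\{-1,1\}^n\to\{-1,1\}$: 1. if $r(F)\ge5$, then $\log\bigl(wt_{1/3}(F)\bigr)\ge c_1\cdot r(F)$; 2. if $k=\deg_{oe}(F)\ge16$, then $\mathrm{mon}_\pm(F)\ge 2^{\,c_2k/\max\{1,\log(n/k)\}}$; 3. if $k=\deg_{oe}(F)\ge16$, then $m(F)\le 2^{-c_3k/\max\{1,\log(n/k)\}}$. In particular, for $k\le n/2$ the exponents in 2 and 3 are $c_2k/\log(n/k)$ and $-c_3k/\log(n/k)$. -/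

import Mathlib

namespace BoolCube

/-- The Boolean cube `{-1, 1}^n`; the units of `ℤ` are exactly `1` and `-1`. -/
abbrev Cube (n : ℕ) : Type := Fin n → ℤˣ

/-- `F(x_1, …, x_n) = F(x_{σ(1)}, …, x_{σ(n)})` for all permutations `σ`. -/
def IsSymm {n : ℕ} (F : Cube n → ℤˣ) : Prop :=
  ∀ (σ : Equiv.Perm (Fin n)) (x : Cube n), F (fun j => x (σ j)) = F x

/-- The Hamming weight of `x`: the number of coordinates equal to `-1`. -/
def hammingWt {n : ℕ} (x : Cube n) : ℕ :=
  (Finset.univ.filter fun j => x j = -1).card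

/-- The predicate (spectrum) `D_F(i)`, `0 ≤ i ≤ n`, of a symmetric function: its value on the input
whose first `i` coordinates are `-1`. See `IsSymm.eq_predicate` for independence of the input. -/
def predicate {n : ℕ} (F : Cube n → ℤˣ) (i : ℕ) : ℤˣ :=
  F fun j => if (j : ℕ) < i then -1 else 1

theorem IsSymm.eq_predicate {n : ℕ} {F : Cube n → ℤˣ} (hF : IsSymm F) (x : Cube n) :
    F x = predicate F (hammingWt x) := by
  classical
  have hle : hammingWt x ≤ n := by
    simpa [hammingWt] using Finset.card_le_univ (Finset.univ.filter fun j => x j = -1)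
  have hcard : Fintype.card {j : Fin n // (j : ℕ) < hammingWt x} =
      Fintype.card {j : Fin n // x j = -1} := by
    rw [Fintype.card_subtype, Fintype.card_subtype, Fin.card_filter_val_lt]
    exact min_eq_right hle
  let e := Fintype.equivOfCardEq hcard
  rw [← hF e.extendSubtype x, predicate]
  congr 1
  funext j
  by_cases hj : (j : ℕ) < hammingWt x
  · rw [if_pos hj]
    exact e.extendSubtype_mem j hj
  · rw [if_neg hj]
    have h := e.extendSubtype_not_mem j hj
    exact (Int.units_eq_one_or _).resolve_right h

/-- The odd-even degree: the number of `i ∈ {0, …, n - 2}` with `D_F(i) ≠ D_F(i + 2)`. -/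
def degOE {n : ℕ} (F : Cube n → ℤˣ) : ℕ :=
  ((Finset.range (n - 1)).filter fun i => predicate F i ≠ predicate F (i + 2)).card

/-- `D_F(i) = D_F(i + 2)` for all `i ∈ [r₀, n - r₁)` (for which `D_F(i + 2)` is defined). -/
def StableOn {n : ℕ} (F : Cube n → ℤˣ) (r₀ r₁ : ℕ) : Prop :=
  ∀ i : ℕ, r₀ ≤ i → i + r₁ < n → i + 2 ≤ n → predicate F i = predicate F (i + 2)

/-- `r(F)`: the least possible `max {r₀, r₁}` over `r₀, r₁ ≤ ⌈n / 2⌉` such that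
`D_F(i) = D_F(i + 2)` for all `i ∈ [r₀, n - r₁)`. -/
noncomputable def rParam {n : ℕ} (F : Cube n → ℤˣ) : ℕ :=
  sInf {r : ℕ | ∃ r₀ r₁ : ℕ, r₀ ≤ (n + 1) / 2 ∧ r₁ ≤ (n + 1) / 2 ∧ StableOn F r₀ r₁ ∧
    r = max r₀ r₁}

/-- If there are least `r₀, r₁ ≤ n / 2` with the stability property, then
`r(F) = max {r₀, r₁}`. (Rounding `n / 2` up matters only when no such pair `r₀, r₁ ≤ n / 2` exists,
which may happen for odd `n`.) -/
theorem rParam_eq_max {n : ℕ} {F : Cube n → ℤˣ} {r₀ r₁ : ℕ}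
    (h₀ : 2 * r₀ ≤ n) (h₁ : 2 * r₁ ≤ n) (h : StableOn F r₀ r₁)
    (hmin : ∀ s₀ s₁ : ℕ, 2 * s₀ ≤ n → 2 * s₁ ≤ n → StableOn F s₀ s₁ → r₀ ≤ s₀ ∧ r₁ ≤ s₁) :
    rParam F = max r₀ r₁ := by
  apply le_antisymm
  · exact Nat.sInf_le ⟨r₀, r₁, by omega, by omega, h, rfl⟩
  · refine le_csInf ⟨_, r₀, r₁, by omega, by omega, h, rfl⟩ ?_
    rintro r ⟨s₀, s₁, hs₀, hs₁, hs, rfl⟩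
    by_cases hc : 2 * s₀ ≤ n ∧ 2 * s₁ ≤ n
    · have := hmin s₀ s₁ hc.1 hc.2 hs
      omega
    · omega

/-- Real multilinear polynomials in `x_1, …, x_n`, given by their coefficients `c_S`, `S ⊆ [n]`.
Every real function on the cube is given by exactly one of them. -/
abbrev MLPoly (n : ℕ) : Type := Finset (Fin n) → ℝ

/-- The value `∑_S c_S ∏_{i ∈ S} x_i`. -/
def MLPoly.eval {n : ℕ} (p : MLPoly n) (x : Cube n) : ℝ :=
  ∑ S : Finset (Fin n), p S * ∏ i ∈ S, ((x i : ℤ) : ℝ)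

/-- The weight `∑_S |c_S|`. -/
def MLPoly.wt {n : ℕ} (p : MLPoly n) : ℝ :=
  ∑ S : Finset (Fin n), |p S|

/-- The number of monomials with nonzero coefficient. -/
noncomputable def MLPoly.numMonomials {n : ℕ} (p : MLPoly n) : ℕ :=
  Set.ncard {S : Finset (Fin n) | p S ≠ 0}

/-- `p` sign represents `F` on all inputs. -/
def SignRepresents {n : ℕ} (p : MLPoly n) (F : Cube n → ℤˣ) : Prop :=
  ∀ x : Cube n, 0 < p.eval x * ((F x : ℤ) : ℝ)

/-- The `ε`-approximate weight `wt_ε(F)`. -/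
noncomputable def approxWt {n : ℕ} (ε : ℝ) (F : Cube n → ℤˣ) : ℝ :=
  sInf {w : ℝ | ∃ p : MLPoly n, (∀ x : Cube n, |p.eval x - ((F x : ℤ) : ℝ)| < ε) ∧ p.wt = w}

/-- The signed monomial complexity `mon_±(F)`. -/
noncomputable def signMon {n : ℕ} (F : Cube n → ℤˣ) : ℕ :=
  sInf {m : ℕ | ∃ p : MLPoly n, SignRepresents p F ∧ p.numMonomials = m}

/-- The margin `m(F)`: the largest value of `min_x p(x) F(x)` over the polynomials `p` of weight at
most `1` that sign represent `F`. -/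
noncomputable def margin {n : ℕ} (F : Cube n → ℤˣ) : ℝ :=
  sSup {δ : ℝ | ∃ p : MLPoly n, p.wt ≤ 1 ∧ SignRepresents p F ∧
    δ = ⨅ x : Cube n, p.eval x * ((F x : ℤ) : ℝ)}

end BoolCube

open BoolCube

/-! All three bounds come from linear programming duality after a random lift. Split the coordinates
into `m` blocks of two pairs, with `b` coordinates frozen to `-1` and `c` to `1`. A selector `z`
chooses one pair per block; the chosen pair holds `w i` twice and the other holds `v i, -v i`. Each
lifted input then has `m + b + 2 |w|` entries equal to `-1`, so `F` becomes a symmetric function of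
`w` that sees only every second value of `D_F`.

Take `φ` on the `m`-cube orthogonal to all parities of degree below `d`. Averaging over `v` kills a
parity that meets an unselected pair in one point, and `φ` kills it unless at least `d` selected
pairs are met in one point. Hence each parity survives for at most a `2^(-d)` fraction of the
selectors (`PureHighDegree.card_liftSum_chi_ne_zero`). A union bound over monomials, or an average
over `z`, turns this into a lower bound on sparsity or on weight.

The dual functions are symmetric: `levelDual` lives on a set `T` of levels, alternates in sign along
`T`, and is orthogonal to parities of degree at most `|T| - 2`. For sign representation, `T` holds
one level from each run of constant sign, so `φ` agrees in sign with `F` and `d` is the number of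
changes in the window. A dyadic cover of the spectrum (`exists_window`) finds a window with a `1 /
max 1 (log (n/k))` share of the changes, up to a constant.

For approximation a single change, far from both ends, is enough. `T` consists of the two levels
around it and widely spaced further levels, so that most of the mass of `φ` sits on those two
(`sum_inv_nodeProd_le`) while `d` stays linear in `r(F)`. -/

namespace BoolCube

/-! ### Parities and Fourier inversion on the cube. -/

/-- The value of the parity `χ_S` at `x`. -/
def chi {n : ℕ} (S : Finset (Fin n)) (x : Cube n) : ℝ := ∏ i ∈ S, ((x i : ℤ) : ℝ)

theorem abs_units (u : ℤˣ) : |((u : ℤ) : ℝ)| = 1 := by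
  rcases Int.units_eq_one_or u with h | h <;> simp [h]

theorem units_mul_self (u : ℤˣ) : ((u : ℤ) : ℝ) * ((u : ℤ) : ℝ) = 1 := by
  rcases Int.units_eq_one_or u with h | h <;> simp [h]

theorem abs_chi {n : ℕ} (S : Finset (Fin n)) (x : Cube n) : |chi S x| = 1 := by
  simp [chi, Finset.abs_prod, abs_units]

theorem MLPoly.eval_eq {n : ℕ} (p : MLPoly n) (x : Cube n) :
    p.eval x = ∑ S, p S * chi S x := rfl

/-- Every real function on the cube is given by a multilinear polynomial. -/
theorem exists_eval_eq {n : ℕ} (f : Cube n → ℝ) : ∃ p : MLPoly n, ∀ x, p.eval x = f x := by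
  refine ⟨fun S => (∑ y, f y * chi S y) / 2 ^ n, fun x => ?_⟩
  have h (y : Cube n) : ∑ S, chi S y * chi S x = if y = x then (2 : ℝ) ^ n else 0 := by
    have : ∑ S, chi S y * chi S x = ∏ i, (1 + ((y i : ℤ) : ℝ) * ((x i : ℤ) : ℝ)) := by
      rw [Finset.prod_one_add, Finset.powerset_univ]
      simp [chi, Finset.prod_mul_distrib]
    rw [this]
    split_ifs with hyx
    · subst hyx
      simp [units_mul_self]
      norm_num
    · obtain ⟨i, hi⟩ := Function.ne_iff.1 hyx
      apply Finset.prod_eq_zero (Finset.mem_univ i)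
      rcases Int.units_eq_one_or (y i) with h | h <;>
        rcases Int.units_eq_one_or (x i) with h' | h' <;> simp_all
  calc MLPoly.eval _ x = ∑ S, ∑ y, f y / 2 ^ n * (chi S y * chi S x) := by
        rw [MLPoly.eval_eq]
        refine Finset.sum_congr rfl fun S _ => ?_
        rw [Finset.sum_div, Finset.sum_mul]
        exact Finset.sum_congr rfl fun y _ => by ring
    _ = f x := by
        rw [Finset.sum_comm]
        simp_rw [← Finset.mul_sum, h]
        simp

/-! ### Lifting a dual function from the `m`-cube along a selector. -/

/-- `φ` is orthogonal to all parities of fewer than `d` variables. -/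
def PureHighDegree {m : ℕ} (φ : Cube m → ℝ) (d : ℕ) : Prop :=
  ∀ A : Finset (Fin m), A.card < d → ∑ w, φ w * chi A w = 0

section Lift

variable {n m b c : ℕ} (e : Fin n ≃ (Fin m × Bool × Bool) ⊕ (Fin b ⊕ Fin c))

/-- The input with `m` blocks of two pairs of coordinates: in block `i` the pair selected by `z i`
holds `w i` twice, the other pair holds `v i` and `-v i`. Of the remaining coordinates, `b` are
`-1` and `c` are `1`. -/
def liftPoint (z : Fin m → Bool) (v w : Cube m) : Cube n := fun j =>
  Sum.elim (fun a => if a.2.1 = z a.1 then w a.1 else if a.2.2 then v a.1 else -v a.1)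
    (Sum.elim (fun _ => -1) (fun _ => 1)) (e j)

theorem hammingWt_liftPoint (z : Fin m → Bool) (v w : Cube m) :
    hammingWt (liftPoint e z v w) = m + b + 2 * hammingWt w := by
  have hb (i : Fin m) : (∑ s : Bool, ∑ t : Bool,
      if (if s = z i then w i else if t = true then v i else -v i) = -1 then 1 else 0) =
        1 + 2 * (if w i = -1 then 1 else 0) := by
    have h1 : (1 : ℤˣ) ≠ -1 := by decide
    rcases Int.units_eq_one_or (w i) with h | h <;> rcases Int.units_eq_one_or (v i) with h' | h' <;>
      cases hz : z i <;> simp only [Fintype.sum_bool] <;> simp [h, h', h1]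
  unfold hammingWt liftPoint
  rw [Finset.card_filter, Finset.card_filter, e.sum_comp (fun a => if (Sum.elim _ _ a = -1) then 1 else 0),
    Fintype.sum_sum_type, Fintype.sum_sum_type, Fintype.sum_prod_type]
  simp only [Fintype.sum_prod_type, Sum.elim_inl, Sum.elim_inr, hb]
  have h1 : (1 : ℤˣ) ≠ -1 := by decide
  simp [Finset.sum_add_distrib, ← Finset.mul_sum, -mul_ite, h1]
  omega

/-- The number of coordinates in `S` that belong to the pair `s` of block `i`. -/
def pairCount (S : Finset (Fin n)) (i : Fin m) (s : Bool) : ℕ :=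
  ∑ t : Bool, if e.symm (Sum.inl (i, s, t)) ∈ S then 1 else 0

/-- The parity factors through the blocks; `κ` collects the frozen coordinates and the signs from
the entries `-v i`, neither of which depends on `v` or `w`. -/
theorem chi_liftPoint (S : Finset (Fin n)) (z : Fin m → Bool) : ∃ κ : ℝ, ∀ v w : Cube m,
    chi S (liftPoint e z v w) = κ * ((∏ i, ((w i : ℤ) : ℝ) ^ pairCount e S i (z i)) *
      ∏ i, ((v i : ℤ) : ℝ) ^ pairCount e S i (!(z i))) := by
  classical
  refine ⟨(∏ a : Fin b ⊕ Fin c, if e.symm (Sum.inr a) ∈ S then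
      (((Sum.elim (fun _ => -1) (fun _ => 1) a : ℤˣ) : ℤ) : ℝ) else 1) *
    ∏ i : Fin m, if e.symm (Sum.inl (i, !(z i), false)) ∈ S then -1 else 1, fun v w => ?_⟩
  have h0 : chi S (liftPoint e z v w) =
      ∏ a, if e.symm a ∈ S then ((liftPoint e z v w (e.symm a) : ℤ) : ℝ) else 1 := by
    rw [e.symm.prod_comp fun j => if j ∈ S then ((liftPoint e z v w j : ℤ) : ℝ) else 1]
    simp [chi]
  rw [h0, Fintype.prod_sum_type, Fintype.prod_prod_type, mul_assoc, mul_comm]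
  congr 1
  · simp [liftPoint]
  · rw [← Finset.prod_mul_distrib, ← Finset.prod_mul_distrib]
    refine Finset.prod_congr rfl fun i _ => ?_
    simp only [Fintype.prod_prod_type, Fintype.prod_bool, pairCount, Fintype.sum_bool, liftPoint,
      Equiv.apply_symm_apply, Sum.elim_inl]
    cases z i <;> simp only [Bool.not_true, Bool.not_false] <;> split_ifs <;> simp_all <;> ring

theorem sum_prod_pow_eq_zero {m : ℕ} (β : Fin m → ℕ) {i : Fin m} (hi : Odd (β i)) :
    ∑ v : Cube m, ∏ i, ((v i : ℤ) : ℝ) ^ β i = 0 := by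
  classical
  have h := Finset.prod_univ_sum (fun _ : Fin m => (Finset.univ : Finset ℤˣ))
    (fun i u => ((u : ℤ) : ℝ) ^ β i)
  rw [Fintype.piFinset_univ] at h
  rw [← h]
  apply Finset.prod_eq_zero (Finset.mem_univ i)
  have hu : (Finset.univ : Finset ℤˣ) = {1, -1} := by decide
  rw [hu, Finset.sum_pair (by decide)]
  simp [hi.neg_one_pow]

theorem prod_pow_eq_chi {m : ℕ} (α : Fin m → ℕ) (w : Cube m) :
    ∏ i, ((w i : ℤ) : ℝ) ^ α i = chi (Finset.univ.filter fun i => Odd (α i)) w := by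
  rw [chi, Finset.prod_filter]
  refine Finset.prod_congr rfl fun i _ => ?_
  split_ifs with h
  · rcases Int.units_eq_one_or (w i) with h' | h' <;> simp [h', h.neg_one_pow]
  · rcases Int.units_eq_one_or (w i) with h' | h' <;>
      simp [h', (Nat.not_odd_iff_even.1 h).neg_one_pow]

/-- The integral of `G` against `φ`, lifted along the selector `z`. -/
noncomputable def liftSum (φ : Cube m → ℝ) (z : Fin m → Bool) (G : Cube n → ℝ) : ℝ :=
  ∑ v, ∑ w, φ w * G (liftPoint e z v w)

variable {φ : Cube m → ℝ} {d : ℕ}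

/-- The integral splits into a sum over `v`, which vanishes if any exponent is odd, times the
pairing of `φ` with the parity of the oddly met selected pairs. -/
theorem PureHighDegree.of_liftSum_chi_ne_zero (hφ : PureHighDegree φ d) {S : Finset (Fin n)}
    {z : Fin m → Bool} (h : liftSum e φ z (chi S) ≠ 0) :
    (∀ i, ¬ Odd (pairCount e S i (!(z i)))) ∧
      d ≤ (Finset.univ.filter fun i => Odd (pairCount e S i (z i))).card := by
  obtain ⟨κ, hκ⟩ := chi_liftPoint e S z
  have key : liftSum e φ z (chi S) =
      κ * ((∑ w, φ w * chi (Finset.univ.filter fun i => Odd (pairCount e S i (z i))) w) *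
        ∑ v : Cube m, ∏ i, ((v i : ℤ) : ℝ) ^ pairCount e S i (!(z i))) := by
    unfold liftSum
    simp_rw [hκ, prod_pow_eq_chi (fun i => pairCount e S i (z i))]
    rw [Finset.sum_mul_sum, Finset.sum_comm, Finset.mul_sum]
    refine Finset.sum_congr rfl fun w _ => ?_
    rw [Finset.mul_sum]
    exact Finset.sum_congr rfl fun v _ => by ring
  constructor
  · intro i hi
    exact h (by rw [key, sum_prod_pow_eq_zero (fun i => pairCount e S i (!(z i))) hi]; simp)
  · by_contra! hd
    exact h (by rw [key, hφ _ hd]; simp)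

/-- In a block with an oddly met pair, a surviving selector must choose that pair. If any selector
survives there are at least `d` such blocks, so at most `m - d` choices remain free. -/
theorem PureHighDegree.card_liftSum_chi_ne_zero (hφ : PureHighDegree φ d) (S : Finset (Fin n)) :
    (Finset.univ.filter fun z => liftSum e φ z (chi S) ≠ 0).card * 2 ^ d ≤ 2 ^ m := by
  classical
  rcases Finset.eq_empty_or_nonempty
    (Finset.univ.filter fun z => liftSum e φ z (chi S) ≠ 0) with h0 | ⟨z₀, hz₀⟩
  · simp [h0]
  let A : Finset (Fin m) := Finset.univ.filter fun i =>
    Odd (pairCount e S i true) ∨ Odd (pairCount e S i false)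
  let B : Finset (Fin m → Bool) := Fintype.piFinset fun i =>
    if i ∈ A then {decide (Odd (pairCount e S i true))} else Finset.univ
  have hdA : d ≤ A.card := by
    refine (hφ.of_liftSum_chi_ne_zero e (Finset.mem_filter.1 hz₀).2).2.trans
      (Finset.card_le_card fun i hi => ?_)
    have := (Finset.mem_filter.1 hi).2
    simp only [A, Finset.mem_filter, Finset.mem_univ, true_and]
    cases hz : z₀ i <;> simp_all
  have hsub : (Finset.univ.filter fun z => liftSum e φ z (chi S) ≠ 0) ⊆ B := by
    intro z hz
    have h1 := (hφ.of_liftSum_chi_ne_zero e (Finset.mem_filter.1 hz).2).1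
    simp only [B, Fintype.mem_piFinset]
    intro i
    split_ifs with hi
    · have h2 := h1 i
      simp only [A, Finset.mem_filter, Finset.mem_univ, true_and] at hi
      cases hz : z i
      · simp_all
      · simp only [hz, Bool.not_true] at h2
        simp [hi.resolve_right h2]
    · simp
  have hB : B.card = 2 ^ (m - A.card) := by
    simp only [B, Fintype.card_piFinset]
    rw [← Finset.prod_mul_prod_compl A]
    rw [Finset.prod_congr rfl (g := fun _ => 1) (fun i hi => by simp [hi]),
      Finset.prod_congr (s₁ := Aᶜ) rfl (g := fun _ => 2)
        (fun i hi => by simp [Finset.mem_compl.1 hi])]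
    simp [Finset.card_compl]
  have hAm : A.card ≤ m := by simpa using Finset.card_le_univ A
  calc _ ≤ 2 ^ (m - A.card) * 2 ^ A.card :=
        Nat.mul_le_mul (hB ▸ Finset.card_le_card hsub) (Nat.pow_le_pow_right (by norm_num) hdA)
    _ = 2 ^ m := by rw [← pow_add, Nat.sub_add_cancel hAm]

theorem liftSum_eval (z : Fin m → Bool) (p : MLPoly n) :
    liftSum e φ z p.eval = ∑ S, p S * liftSum e φ z (chi S) := by
  simp only [liftSum, MLPoly.eval_eq, Finset.mul_sum]
  rw [Finset.sum_comm' (t' := Finset.univ) (s' := fun _ => Finset.univ) (by simp)]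
  conv_rhs => rw [Finset.sum_comm]
  rw [Finset.sum_comm]
  refine Finset.sum_congr rfl fun v _ => ?_
  rw [Finset.sum_comm]
  exact Finset.sum_congr rfl fun S _ => Finset.sum_congr rfl fun w _ => by ring

theorem abs_liftSum_chi_le (z : Fin m → Bool) (S : Finset (Fin n)) :
    |liftSum e φ z (chi S)| ≤ 2 ^ m * ∑ w, |φ w| := by
  calc |liftSum e φ z (chi S)| ≤ ∑ v : Cube m, ∑ w, |φ w| := by
        refine (Finset.abs_sum_le_sum_abs _ _).trans (Finset.sum_le_sum fun v _ => ?_)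
        refine (Finset.abs_sum_le_sum_abs _ _).trans (Finset.sum_le_sum fun w _ => ?_)
        rw [abs_mul, abs_chi, mul_one]
    _ = _ := by simp [Fintype.card_units_int]

/-- Each monomial contributes for at most `2^(m-d)` selectors, and then at most the trivial bound.
-/
theorem PureHighDegree.abs_sum_liftSum_eval_le (hφ : PureHighDegree φ d) (p : MLPoly n) :
    |∑ z, liftSum e φ z p.eval| * 2 ^ d ≤ p.wt * (2 ^ m * (2 ^ m * ∑ w, |φ w|)) := by
  have h1 (S : Finset (Fin n)) : |∑ z, liftSum e φ z (chi S)| * 2 ^ d ≤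
      2 ^ m * (2 ^ m * ∑ w, |φ w|) := by
    have hc : ((Finset.univ.filter fun z => liftSum e φ z (chi S) ≠ 0).card : ℝ) * 2 ^ d ≤ 2 ^ m :=
      mod_cast hφ.card_liftSum_chi_ne_zero e S
    have : |∑ z, liftSum e φ z (chi S)| ≤
        (Finset.univ.filter fun z => liftSum e φ z (chi S) ≠ 0).card * (2 ^ m * ∑ w, |φ w|) := by
      rw [← Finset.sum_filter_ne_zero, ← nsmul_eq_mul]
      exact (Finset.abs_sum_le_sum_abs _ _).trans
        (Finset.sum_le_card_nsmul _ _ _ fun z _ => abs_liftSum_chi_le e z S)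
    have h0 : 0 ≤ 2 ^ m * ∑ w, |φ w| := by positivity
    calc _ ≤ _ * 2 ^ d := mul_le_mul_of_nonneg_right this (by positivity)
      _ = (Finset.univ.filter fun z => liftSum e φ z (chi S) ≠ 0).card * 2 ^ d *
          (2 ^ m * ∑ w, |φ w|) := by ring
      _ ≤ _ := mul_le_mul_of_nonneg_right hc h0
  simp_rw [liftSum_eval]
  rw [Finset.sum_comm, MLPoly.wt, Finset.sum_mul]
  simp_rw [← Finset.mul_sum]
  calc _ ≤ (∑ S, |p S| * |∑ z, liftSum e φ z (chi S)|) * 2 ^ d := by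
        gcongr
        refine (Finset.abs_sum_le_sum_abs _ _).trans_eq ?_
        simp_rw [abs_mul]
    _ ≤ _ := by
        rw [Finset.sum_mul]
        refine Finset.sum_le_sum fun S _ => ?_
        rw [mul_assoc]
        exact mul_le_mul_of_nonneg_left (h1 S) (abs_nonneg _)

/-- Union bound: fewer than `2^d` monomials, each surviving for at most `2^(m-d)` selectors, leave a
selector that kills them all. -/
theorem PureHighDegree.exists_liftSum_eval_eq_zero (hφ : PureHighDegree φ d) {p : MLPoly n}
    (hp : p.numMonomials < 2 ^ d) : ∃ z, liftSum e φ z p.eval = 0 := by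
  classical
  let T : Finset (Finset (Fin n)) := Finset.univ.filter fun S => p S ≠ 0
  have hT : T.card = p.numMonomials := by
    rw [MLPoly.numMonomials, ← Set.ncard_coe_finset]
    simp [T]
  let bad (S : Finset (Fin n)) : Finset (Fin m → Bool) :=
    Finset.univ.filter fun z => liftSum e φ z (chi S) ≠ 0
  have hbad : (T.biUnion bad).card < Fintype.card (Fin m → Bool) := by
    have h2 : (T.biUnion bad).card * 2 ^ d ≤ T.card * 2 ^ m := by
      calc _ ≤ (∑ S ∈ T, (bad S).card) * 2 ^ d := Nat.mul_le_mul_right _ Finset.card_biUnion_le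
        _ ≤ T.card * 2 ^ m := by
          rw [Finset.sum_mul, ← smul_eq_mul]
          exact Finset.sum_le_card_nsmul _ _ _ fun S _ => hφ.card_liftSum_chi_ne_zero e S
    have h3 : T.card * 2 ^ m < 2 ^ d * 2 ^ m :=
      Nat.mul_lt_mul_of_pos_right (hT ▸ hp) (by positivity)
    simp only [Fintype.card_fun, Fintype.card_bool, Fintype.card_fin]
    exact lt_of_mul_lt_mul_right (by linarith) (Nat.zero_le (2 ^ d))
  obtain ⟨z, hz⟩ : ∃ z, z ∉ T.biUnion bad := by
    by_contra! h
    rw [Finset.eq_univ_of_forall h, Finset.card_univ] at hbad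
    exact lt_irrefl _ hbad
  refine ⟨z, ?_⟩
  rw [liftSum_eval]
  refine Finset.sum_eq_zero fun S _ => ?_
  by_cases hS : p S = 0
  · simp [hS]
  · have : z ∉ bad S := fun h => hz (Finset.mem_biUnion.2 ⟨S, by simp [T, hS], h⟩)
    have : liftSum e φ z (chi S) = 0 := by simpa [bad] using this
    simp [this]

end Lift
-- Symmetric dual functions supported on prescribed levels.
theorem chi_update_neg {m : ℕ} {C : Finset (Fin m)} {i : Fin m} (hi : i ∈ C) (w : Cube m) :
    chi C (Function.update w i (-w i)) = -chi C w := by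
  classical
  rw [chi, chi, ← Finset.mul_prod_erase _ _ hi, ← Finset.mul_prod_erase C _ hi]
  have : ∏ j ∈ C.erase i, ((Function.update w i (-w i) j : ℤ) : ℝ) =
      ∏ j ∈ C.erase i, ((w j : ℤ) : ℝ) :=
    Finset.prod_congr rfl fun j hj => by rw [Function.update_of_ne (Finset.ne_of_mem_erase hj)]
  rw [this]
  simp

/-- The power expands into products of `k` coordinate indicators. Each product misses some
coordinate of `C`, and flipping that coordinate cancels the terms in pairs. -/
theorem sum_chi_mul_hammingWt_pow {m : ℕ} {C : Finset (Fin m)} {k : ℕ} (hk : k < C.card) :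
    ∑ w : Cube m, chi C w * (hammingWt w : ℝ) ^ k = 0 := by
  classical
  have h (w : Cube m) : (hammingWt w : ℝ) ^ k =
      ∑ f : Fin k → Fin m, ∏ t, if w (f t) = -1 then (1 : ℝ) else 0 := by
    rw [hammingWt, Finset.card_filter, Nat.cast_sum, Fintype.sum_pow]
    simp
  simp_rw [h, Finset.mul_sum]
  rw [Finset.sum_comm]
  refine Finset.sum_eq_zero fun f _ => ?_
  obtain ⟨i, hiC, hi⟩ : ∃ i ∈ C, i ∉ Finset.univ.image f := by
    by_contra! hC
    have := (Finset.card_le_card hC).trans Finset.card_image_le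
    simp only [Finset.card_univ, Fintype.card_fin] at this
    omega
  have hi' (t : Fin k) : f t ≠ i := fun h => hi (Finset.mem_image.2 ⟨t, Finset.mem_univ t, h⟩)
  refine Finset.sum_involution (fun w _ => Function.update w i (-w i)) ?_ ?_ (by simp) (by simp)
  · intro w _
    rw [chi_update_neg hiC]
    simp [Function.update_of_ne (hi' _)]
  · intro w _ _ hw
    have := congrFun hw i
    simp only [Function.update_self] at this
    rcases Int.units_eq_one_or (w i) with h' | h' <;> rw [h'] at this <;> exact absurd this (by decide)

theorem sum_chi_mul_eval_hammingWt {m : ℕ} {C : Finset (Fin m)} (g : Polynomial ℝ)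
    (hg : g.natDegree < C.card) : ∑ w : Cube m, chi C w * g.eval (hammingWt w : ℝ) = 0 := by
  simp_rw [Polynomial.eval_eq_sum_range, Finset.mul_sum]
  rw [Finset.sum_comm]
  refine Finset.sum_eq_zero fun k hk => ?_
  have hk' : k < C.card := by
    have := Finset.mem_range.1 hk
    omega
  calc _ = g.coeff k * ∑ w : Cube m, chi C w * (hammingWt w : ℝ) ^ k := by
        rw [Finset.mul_sum]
        exact Finset.sum_congr rfl fun w _ => by ring
    _ = 0 := by rw [sum_chi_mul_hammingWt_pow hk', mul_zero]

theorem chi_univ {m : ℕ} (w : Cube m) : chi Finset.univ w = (-1) ^ hammingWt w := by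
  rw [chi, hammingWt, ← Finset.prod_const, Finset.prod_filter]
  refine Finset.prod_congr rfl fun i _ => ?_
  rcases Int.units_eq_one_or (w i) with h | h <;> rw [h]
  · rw [if_neg (by decide)]; simp
  · simp

theorem chi_univ_mul_chi {m : ℕ} (A : Finset (Fin m)) (w : Cube m) :
    chi Finset.univ w * chi A w = chi Aᶜ w := by
  rw [chi, ← Finset.prod_mul_prod_compl A]
  change chi A w * chi Aᶜ w * chi A w = chi Aᶜ w
  have h : chi A w * chi A w = 1 := by
    rw [chi, ← Finset.prod_mul_distrib]
    exact Finset.prod_eq_one fun i _ => units_mul_self _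
  linear_combination chi Aᶜ w * h

/-- The signed factor at level `j` of the symmetric function on the `m`-cube that lives on the
levels in `T` and is orthogonal to all polynomials of low degree. -/
def levelDual (m : ℕ) (T : Finset ℕ) (j : ℕ) : ℝ :=
  (-1) ^ j * ∏ t ∈ Finset.range (m + 1) \ T, ((t : ℝ) - j)

/-- The sign `(-1)^|w|` is the full parity and turns `χ_A` into the parity of the complement, which
has more than `m + 1 - |T|` variables. The remaining factor is a polynomial in `|w|` of at most that
degree. -/
theorem pureHighDegree_levelDual {m d : ℕ} {T : Finset ℕ} (hT : T ⊆ Finset.range (m + 1))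
    (hd : d < T.card) : PureHighDegree (fun w : Cube m => levelDual m T (hammingWt w)) d := by
  intro A hA
  let g : Polynomial ℝ := ∏ t ∈ Finset.range (m + 1) \ T, (Polynomial.C (t : ℝ) - Polynomial.X)
  have hg : g.natDegree ≤ m + 1 - T.card := by
    refine (Polynomial.natDegree_prod_le _ _).trans ?_
    calc _ ≤ ∑ t ∈ Finset.range (m + 1) \ T, 1 := Finset.sum_le_sum fun t _ =>
          (Polynomial.natDegree_sub_le _ _).trans (by simp)
      _ = m + 1 - T.card := by simp [Finset.card_sdiff_of_subset hT]
  have hTm := Finset.card_le_card hT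
  rw [Finset.card_range] at hTm
  rw [← sum_chi_mul_eval_hammingWt (C := Aᶜ) g
    (by rw [Finset.card_compl, Fintype.card_fin]; omega)]
  refine Finset.sum_congr rfl fun w _ => ?_
  rw [← chi_univ_mul_chi, chi_univ]
  simp only [levelDual, g, Polynomial.eval_prod, Polynomial.eval_sub, Polynomial.eval_C, Polynomial.eval_X]
  ring

theorem levelDual_eq_zero {m : ℕ} {T : Finset ℕ} {j : ℕ} (hj : j ≤ m) (hjT : j ∉ T) :
    levelDual m T j = 0 := by
  rw [levelDual, Finset.prod_eq_zero (i := j) (by simp [hjT]; omega) (by simp), mul_zero]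

theorem levelDual_ne_zero {m : ℕ} {T : Finset ℕ} {j : ℕ} (hjT : j ∈ T) :
    levelDual m T j ≠ 0 := by
  refine mul_ne_zero (by simp) (Finset.prod_ne_zero_iff.2 fun t ht => ?_)
  rw [sub_ne_zero]
  rintro h
  rw [Nat.cast_inj] at h
  exact (Finset.mem_sdiff.1 ht).2 (h ▸ hjT)

theorem neg_one_pow_mul_prod_sub_pos {T : Finset ℕ} {j : ℕ} (h : j ∉ T) :
    0 < (-1 : ℝ) ^ (T.filter (· < j)).card * ∏ t ∈ T, ((t : ℝ) - j) := by
  rw [← Finset.prod_const, Finset.prod_filter, ← Finset.prod_mul_distrib]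
  refine Finset.prod_pos fun t ht => ?_
  split_ifs with htj
  · have : (t : ℝ) < j := mod_cast htj
    linarith
  · have : (j : ℝ) < t := mod_cast lt_of_le_of_ne (not_lt.1 htj) fun hj => h (hj ▸ ht)
    linarith

/-- The signs of `levelDual` alternate along the elements of `T`. -/
theorem levelDual_sign {m : ℕ} {T : Finset ℕ} (hT : T ⊆ Finset.range (m + 1)) {j : ℕ}
    (hjT : j ∈ T) : 0 < (-1 : ℝ) ^ (T.filter (· < j)).card * levelDual m T j := by
  have hj : j < m + 1 := Finset.mem_range.1 (hT hjT)
  have h := neg_one_pow_mul_prod_sub_pos (T := Finset.range (m + 1) \ T) (j := j) (by simp [hjT])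
  have hc : (T.filter (· < j)).card + ((Finset.range (m + 1) \ T).filter (· < j)).card = j := by
    rw [← Finset.card_union_of_disjoint, ← Finset.filter_union, Finset.union_sdiff_of_subset hT]
    · have : (Finset.range (m + 1)).filter (· < j) = Finset.range j := by ext; simp; omega
      rw [this, Finset.card_range]
    · exact Finset.disjoint_filter_filter Finset.disjoint_sdiff
  generalize (T.filter (· < j)).card = a at *
  generalize ((Finset.range (m + 1) \ T).filter (· < j)).card = b' at *
  subst hc
  rw [levelDual, ← mul_assoc, ← pow_add]
  rwa [show a + (a + b') = b' + 2 * a by ring, pow_add (-1 : ℝ) b', pow_mul, neg_one_sq, one_pow,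
    mul_one]

theorem card_level {m : ℕ} (j : ℕ) :
    (Finset.univ.filter fun w : Cube m => hammingWt w = j).card = m.choose j := by
  classical
  conv_rhs => rw [← Finset.card_fin m, ← Finset.card_powersetCard]
  refine Finset.card_bij' (fun w _ => Finset.univ.filter fun i => w i = -1)
    (fun B _ i => if i ∈ B then -1 else 1) ?_ ?_ ?_ ?_
  · intro w hw
    exact Finset.mem_powersetCard.2 ⟨Finset.subset_univ _, (Finset.mem_filter.1 hw).2⟩
  · intro B hB
    have h1 : (1 : ℤˣ) ≠ -1 := by decide
    refine Finset.mem_filter.2 ⟨Finset.mem_univ _, ?_⟩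
    simpa [Finset.mem_powersetCard, hammingWt, h1] using hB
  · intro w _
    funext i
    rcases Int.units_eq_one_or (w i) with h | h <;> simp [h]
  · intro B _
    have h1 : (1 : ℤˣ) ≠ -1 := by decide
    ext i
    simp [h1]

theorem hammingWt_le {m : ℕ} (w : Cube m) : hammingWt w ≤ m := by
  simpa [hammingWt] using Finset.card_le_univ (Finset.univ.filter fun j => w j = -1)

theorem sum_hammingWt {m : ℕ} (h : ℕ → ℝ) :
    ∑ w : Cube m, h (hammingWt w) = ∑ j ∈ Finset.range (m + 1), m.choose j * h j := by
  rw [← Finset.sum_fiberwise_of_maps_to (t := Finset.range (m + 1)) (g := hammingWt)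
    (fun w _ => Finset.mem_range.2 (Nat.lt_succ_of_le (hammingWt_le w)))]
  refine Finset.sum_congr rfl fun j _ => ?_
  rw [Finset.sum_congr rfl (g := fun _ => h j) (fun w hw => by rw [(Finset.mem_filter.1 hw).2]),
    Finset.sum_const, card_level, nsmul_eq_mul]

theorem prod_range_erase_abs_sub {m j : ℕ} (hj : j ≤ m) :
    ∏ t ∈ (Finset.range (m + 1)).erase j, |(t : ℝ) - j| = (j.factorial * (m - j).factorial : ℕ) := by
  induction m, hj using Nat.le_induction with
  | base =>
    rw [Finset.range_add_one, Finset.erase_insert (by simp), Nat.sub_self, Nat.factorial_zero, mul_one,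
      ← Finset.prod_range_reflect, ← Finset.prod_range_add_one_eq_factorial, Nat.cast_prod]
    refine Finset.prod_congr rfl fun t ht => ?_
    have := Finset.mem_range.1 ht
    rw [abs_sub_comm, ← Nat.cast_sub (by omega), Nat.abs_cast]
    congr 1
    omega
  | succ m hm ih =>
    rw [Finset.range_add_one, Finset.erase_insert_of_ne (by omega), Finset.prod_insert (by simp), ih,
      Nat.sub_add_comm hm, Nat.factorial_succ, ← Nat.cast_sub (by omega), Nat.abs_cast,
      Nat.sub_add_comm hm]
    push_cast
    ring

/-- The total mass at a level of `T`. -/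
theorem choose_mul_abs_levelDual {m : ℕ} {T : Finset ℕ} (hT : T ⊆ Finset.range (m + 1)) {j : ℕ}
    (hjT : j ∈ T) :
    (m.choose j * |levelDual m T j|) * ∏ t ∈ T.erase j, |(t : ℝ) - j| = m.factorial := by
  have hj : j ≤ m := Nat.lt_succ_iff.1 (Finset.mem_range.1 (hT hjT))
  -- The product of distances to all other levels is `j! (m - j)!`; the part outside `T` is
  -- `levelDual` up to sign.
  have hu : (Finset.range (m + 1)).erase j = (Finset.range (m + 1) \ T) ∪ T.erase j := by
    ext t
    have := @hT t
    by_cases h : t = j <;> by_cases h' : t ∈ T <;> simp_all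
  have := prod_range_erase_abs_sub hj
  rw [hu, Finset.prod_union (Finset.disjoint_of_subset_right (Finset.erase_subset _ _)
    Finset.sdiff_disjoint)] at this
  rw [levelDual, abs_mul, abs_pow, abs_neg, abs_one, one_pow, one_mul, Finset.abs_prod, mul_assoc, this,
    ← Nat.cast_mul, ← mul_assoc, Nat.choose_mul_factorial_mul_factorial hj]

theorem eq_mul_neg_one_pow_changes (g : ℕ → ℤˣ) (j : ℕ) :
    g j = g 0 * (-1) ^ ((Finset.range j).filter fun t => g t ≠ g (t + 1)).card := by
  induction j with
  | zero => simp
  | succ j ih =>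
    rw [Finset.range_add_one, Finset.filter_insert]
    by_cases h : g j = g (j + 1)
    · rw [if_neg (not_not.2 h), ← ih, h]
    · rw [if_pos h, Finset.card_insert_of_notMem
        (fun hj => absurd (Finset.mem_filter.1 hj).1 Finset.notMem_range_self), pow_succ, ← mul_assoc, ← ih]
      rcases Int.units_eq_one_or (g j) with h1 | h1 <;>
        rcases Int.units_eq_one_or (g (j + 1)) with h2 | h2 <;> rw [h1, h2] at h ⊢ <;>
        first | exact absurd rfl h | simp

/-- A function of sign pattern `g` on the levels of the `m`-cube is dual to low degree. -/
theorem exists_pureHighDegree_sign (m : ℕ) (g : ℕ → ℤˣ) : ∃ φ : Cube m → ℝ,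
    PureHighDegree φ ((Finset.range m).filter fun t => g t ≠ g (t + 1)).card ∧
      (∀ w, φ w = |φ w| * ((g (hammingWt w) : ℤ) : ℝ)) ∧ ∃ w, φ w ≠ 0 := by
  set U := (Finset.range m).filter fun t => g t ≠ g (t + 1) with hU
  have hmU : m ∉ U := by simp [hU]
  -- The set `insert m U` holds the last level of each run on which `g` is constant, so `g`
  -- alternates along it just as `levelDual` does; `g 0` fixes the global sign.
  have hT : insert m U ⊆ Finset.range (m + 1) := by
    intro t ht
    rcases Finset.mem_insert.1 ht with rfl | ht
    · simp
    · have := Finset.mem_range.1 (Finset.mem_filter.1 ht).1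
      simp
      omega
  have hp := pureHighDegree_levelDual (d := U.card) hT (by rw [Finset.card_insert_of_notMem hmU]; simp)
  have hsign (j : ℕ) (hj : j ≤ m) :
      0 ≤ levelDual m (insert m U) j * ((g 0 : ℤ) : ℝ) * ((g j : ℤ) : ℝ) := by
    by_cases hjT : j ∈ insert m U
    · have h1 := levelDual_sign hT hjT
      have h2 : (insert m U).filter (· < j) = (Finset.range j).filter fun t => g t ≠ g (t + 1) := by
        ext t
        simp only [hU, Finset.mem_filter, Finset.mem_insert, Finset.mem_range]
        constructor
        · rintro ⟨rfl | h, h'⟩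
          · omega
          · exact ⟨h', h.2⟩
        · rintro ⟨h, h'⟩
          exact ⟨Or.inr ⟨by omega, h'⟩, h⟩
      rw [h2] at h1
      rw [eq_mul_neg_one_pow_changes g j]
      push_cast
      have := units_mul_self (g 0)
      calc (0 : ℝ) ≤ _ := h1.le
        _ = _ := by linear_combination (-(-1 : ℝ) ^ ((Finset.range j).filter fun t => g t ≠ g (t + 1)).card
            * levelDual m (insert m U) j) * this
    · rw [levelDual_eq_zero hj hjT]
      simp
  refine ⟨fun w => levelDual m (insert m U) (hammingWt w) * ((g 0 : ℤ) : ℝ), ?_, ?_, ?_⟩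
  · intro A hA
    rw [← mul_zero ((g 0 : ℤ) : ℝ), ← hp A hA, Finset.mul_sum]
    exact Finset.sum_congr rfl fun w _ => by ring
  · intro w
    have h := hsign _ (hammingWt_le w)
    rcases Int.units_eq_one_or (g (hammingWt w)) with h1 | h1 <;> rw [h1] at h ⊢
    · simp only [Units.val_one, Int.cast_one, mul_one] at h ⊢
      rw [abs_of_nonneg h]
    · simp only [Units.val_neg, Units.val_one, Int.cast_neg, Int.cast_one, mul_neg, mul_one] at h ⊢
      rw [abs_of_nonpos (by linarith), neg_neg]
  · refine ⟨fun _ => -1, ?_⟩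
    have : hammingWt (fun _ : Fin m => (-1 : ℤˣ)) = m := by simp [hammingWt]
    simp only [this]
    exact mul_ne_zero (levelDual_ne_zero (Finset.mem_insert_self _ _)) (by simp)

/-! ### Sparsity and margin bounds from one window of the spectrum. -/

section Window

variable {n m b c : ℕ} {F : Cube n → ℤˣ}

theorem nonempty_equiv_blocks (h : 4 * m + b + c = n) :
    Nonempty (Fin n ≃ (Fin m × Bool × Bool) ⊕ (Fin b ⊕ Fin c)) :=
  ⟨Fintype.equivOfCardEq (by simp; omega)⟩

/-- The number of changes of `D_F` between consecutive members of `m + b, m + b + 2, …, 3m + b`. -/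
def windowChanges (F : Cube n → ℤˣ) (m b : ℕ) : ℕ :=
  ((Finset.range m).filter fun t =>
    predicate F (m + b + 2 * t) ≠ predicate F (m + b + 2 * (t + 1))).card

theorem IsSymm.apply_liftPoint (hF : IsSymm F)
    (e : Fin n ≃ (Fin m × Bool × Bool) ⊕ (Fin b ⊕ Fin c)) (z : Fin m → Bool) (v w : Cube m) :
    F (liftPoint e z v w) = predicate F (m + b + 2 * hammingWt w) := by
  rw [hF.eq_predicate, hammingWt_liftPoint]

/-- With too few monomials some selector makes the integral of `p` zero, but `φ` has the sign of `F`
on lifted inputs, which makes every such integral positive. -/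
theorem IsSymm.two_pow_windowChanges_le_numMonomials (hF : IsSymm F) (h : 4 * m + b + c = n)
    {p : MLPoly n} (hp : SignRepresents p F) : 2 ^ windowChanges F m b ≤ p.numMonomials := by
  obtain ⟨e⟩ := nonempty_equiv_blocks h
  obtain ⟨φ, hφ, hs, w₀, hw₀⟩ :=
    exists_pureHighDegree_sign m fun t => predicate F (m + b + 2 * t)
  by_contra! hlt
  obtain ⟨z, hz⟩ := hφ.exists_liftSum_eval_eq_zero e hlt
  refine absurd hz (ne_of_gt ?_)
  have hnn (v w : Cube m) : φ w * p.eval (liftPoint e z v w) =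
      |φ w| * (p.eval (liftPoint e z v w) * ((F (liftPoint e z v w) : ℤ) : ℝ)) := by
    rw [hF.apply_liftPoint]
    conv_lhs => rw [hs w]
    ring
  refine Finset.sum_pos (fun v _ => ?_) Finset.univ_nonempty
  refine Finset.sum_pos' (fun w _ => ?_) ⟨w₀, Finset.mem_univ _, ?_⟩
  · rw [hnn]
    exact mul_nonneg (abs_nonneg _) (hp _).le
  · rw [hnn]
    exact mul_pos (abs_pos.2 hw₀) (hp _)

/-- On lifted inputs `φ p = |φ| F p ≥ δ |φ|`; compare the sum over all selectors with the weight
bound. -/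
theorem IsSymm.le_of_forall_le_eval (hF : IsSymm F) (h : 4 * m + b + c = n) {p : MLPoly n}
    (hp : p.wt ≤ 1) {δ : ℝ} (hδ : ∀ x, δ ≤ p.eval x * ((F x : ℤ) : ℝ)) :
    δ ≤ 1 / 2 ^ windowChanges F m b := by
  obtain ⟨e⟩ := nonempty_equiv_blocks h
  obtain ⟨φ, hφ, hs, w₀, hw₀⟩ :=
    exists_pureHighDegree_sign m fun t => predicate F (m + b + 2 * t)
  have hpos : 0 < ∑ w, |φ w| :=
    Finset.sum_pos' (fun w _ => abs_nonneg _) ⟨w₀, Finset.mem_univ _, abs_pos.2 hw₀⟩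
  have hle := hφ.abs_sum_liftSum_eval_le e p
  change _ * 2 ^ windowChanges F m b ≤ _ at hle
  have hlow : δ * (2 ^ m * (2 ^ m * ∑ w, |φ w|)) ≤ ∑ z, liftSum e φ z p.eval := by
    calc _ = ∑ z : Fin m → Bool, ∑ v : Cube m, ∑ w, δ * |φ w| := by
          simp only [← Finset.mul_sum, Finset.sum_const, Finset.card_univ, Fintype.card_fun,
            Fintype.card_bool, Fintype.card_fin, Fintype.card_units_int, nsmul_eq_mul]
          push_cast
          ring
      _ ≤ _ := by
          refine Finset.sum_le_sum fun z _ => Finset.sum_le_sum fun v _ =>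
            Finset.sum_le_sum fun w _ => ?_
          have h1 := hδ (liftPoint e z v w)
          rw [hF.apply_liftPoint] at h1
          calc δ * |φ w| ≤ _ * |φ w| := mul_le_mul_of_nonneg_right h1 (abs_nonneg _)
            _ = |φ w| * ((predicate F (m + b + 2 * hammingWt w) : ℤ) : ℝ) *
                p.eval (liftPoint e z v w) := by ring
            _ = _ := by rw [← hs w]
  have hK : 0 < 2 ^ m * (2 ^ m * ∑ w, |φ w|) := by positivity
  rw [le_div_iff₀ (by positivity)]
  have h2 : (0 : ℝ) < 2 ^ windowChanges F m b := by positivity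
  have h3 := mul_le_mul_of_nonneg_right (hlow.trans (le_abs_self _)) h2.le
  have h4 := mul_le_mul_of_nonneg_right hp hK.le
  refine le_of_mul_le_mul_right ?_ hK
  linarith

end Window

/-! ### Covering the changes of the spectrum by windows. -/

/-- The number of `i` in `[a, b)` with `D_F(i) ≠ D_F(i + 2)`. -/
def changesIn {n : ℕ} (F : Cube n → ℤˣ) (a b : ℕ) : ℕ :=
  ((Finset.Ico a b).filter fun i => predicate F i ≠ predicate F (i + 2)).card

section Cover

variable {n : ℕ} (F : Cube n → ℤˣ)

theorem degOE_eq_changesIn : degOE F = changesIn F 0 (n - 1) := by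
  rw [degOE, changesIn, Finset.range_eq_Ico]

theorem changesIn_le (a b : ℕ) : changesIn F a b ≤ b - a :=
  (Finset.card_filter_le _ _).trans_eq (Nat.card_Ico a b)

theorem changesIn_le_add (a b c : ℕ) : changesIn F a c ≤ changesIn F a b + changesIn F b c := by
  refine le_trans (Finset.card_le_card ?_) (Finset.card_union_le _ _)
  intro i hi
  simp only [Finset.mem_filter, Finset.mem_union, Finset.mem_Ico] at hi ⊢
  rcases lt_or_ge i b with h | h
  · exact Or.inl ⟨⟨hi.1.1, h⟩, hi.2⟩
  · exact Or.inr ⟨⟨h, hi.1.2⟩, hi.2⟩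

theorem changesIn_mono {a b a' b' : ℕ} (ha : a' ≤ a) (hb : b ≤ b') :
    changesIn F a b ≤ changesIn F a' b' :=
  Finset.card_le_card (Finset.filter_subset_filter _ (Finset.Ico_subset_Ico ha hb))

/-- A window sees levels of one parity, so two windows shifted by one are needed. -/
theorem changesIn_le_windowChanges (m b : ℕ) :
    changesIn F (m + b) (m + b + 2 * m) ≤ windowChanges F m b + windowChanges F m (b + 1) := by
  classical
  have hsub : (Finset.Ico (m + b) (m + b + 2 * m)).filter
      (fun i => predicate F i ≠ predicate F (i + 2)) ⊆
      (((Finset.range m).filter fun t =>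
        predicate F (m + b + 2 * t) ≠ predicate F (m + b + 2 * (t + 1))).image
          fun t => m + b + 2 * t) ∪
      (((Finset.range m).filter fun t =>
        predicate F (m + (b + 1) + 2 * t) ≠ predicate F (m + (b + 1) + 2 * (t + 1))).image
          fun t => m + (b + 1) + 2 * t) := by
    intro i hi
    simp only [Finset.mem_filter, Finset.mem_union, Finset.mem_Ico, Finset.mem_image,
      Finset.mem_range] at hi ⊢
    obtain ⟨⟨h1, h2⟩, h3⟩ := hi
    rcases Nat.even_or_odd' (i - (m + b)) with ⟨t, ht | ht⟩
    · obtain rfl : i = m + b + 2 * t := by omega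
      exact Or.inl ⟨t, ⟨by omega, h3⟩, rfl⟩
    · obtain rfl : i = m + (b + 1) + 2 * t := by omega
      exact Or.inr ⟨t, ⟨by omega, h3⟩, rfl⟩
  exact (Finset.card_le_card hsub).trans ((Finset.card_union_le _ _).trans
    (Nat.add_le_add Finset.card_image_le Finset.card_image_le))

variable {F} {x : ℝ}

theorem changesIn_window_le (hx : ∀ m b : ℕ, 4 * m + b ≤ n → (windowChanges F m b : ℝ) ≤ x)
    {m b : ℕ} (h : 4 * m + b + 1 ≤ n) : (changesIn F (m + b) (m + b + 2 * m) : ℝ) ≤ 2 * x := by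
  have h1 : (changesIn F (m + b) (m + b + 2 * m) : ℝ) ≤
      windowChanges F m b + windowChanges F m (b + 1) := mod_cast changesIn_le_windowChanges F m b
  linarith [hx m b (by omega), hx m (b + 1) (by omega)]

/-- Count the first `M` positions trivially; each dyadic interval `[2^s M, 2^(s+1) M)` lies in the
window range `[m, 3m)` with `m = 2^s M`. -/
theorem changesIn_left_le (hx : ∀ m b : ℕ, 4 * m + b ≤ n → (windowChanges F m b : ℝ) ≤ x)
    (M t : ℕ) (ht : ∀ s < t, 4 * (2 ^ s * M) + 1 ≤ n) :
    (changesIn F 0 (2 ^ t * M) : ℝ) ≤ M + t * (2 * x) := by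
  induction t with
  | zero => simpa using changesIn_le F 0 M
  | succ t ih =>
    have h1 : (changesIn F 0 (2 ^ (t + 1) * M) : ℝ) ≤
        changesIn F 0 (2 ^ t * M) + changesIn F (2 ^ t * M) (2 ^ (t + 1) * M) :=
      mod_cast changesIn_le_add F _ _ _
    have h2 : (changesIn F (2 ^ t * M) (2 ^ (t + 1) * M) : ℝ) ≤
        changesIn F (2 ^ t * M + 0) (2 ^ t * M + 0 + 2 * (2 ^ t * M)) :=
      mod_cast changesIn_mono F (by omega) (by rw [pow_succ, mul_right_comm]; omega)
    have h3 := changesIn_window_le hx (m := 2 ^ t * M) (b := 0) (ht t (by omega))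
    have h4 := ih fun s hs => ht s (by omega)
    push_cast
    linarith

theorem changesIn_right_le (hx : ∀ m b : ℕ, 4 * m + b ≤ n → (windowChanges F m b : ℝ) ≤ x)
    (M t : ℕ) (ht : ∀ s < t, 4 * (2 ^ s * M) + 1 ≤ n) :
    (changesIn F (n - 1 - 2 ^ t * M) (n - 1) : ℝ) ≤ M + t * (2 * x) := by
  induction t with
  | zero =>
    have := changesIn_le F (n - 1 - M) (n - 1)
    simpa using this.trans (by omega : _ ≤ M)
  | succ t ih =>
    have h1 : (changesIn F (n - 1 - 2 ^ (t + 1) * M) (n - 1) : ℝ) ≤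
        changesIn F (n - 1 - 2 ^ (t + 1) * M) (n - 1 - 2 ^ t * M) +
          changesIn F (n - 1 - 2 ^ t * M) (n - 1) :=
      mod_cast changesIn_le_add F _ _ _
    have ht' := ht t (by omega)
    obtain ⟨b, hb⟩ := Nat.exists_eq_add_of_le ht'
    have h2 : (changesIn F (n - 1 - 2 ^ (t + 1) * M) (n - 1 - 2 ^ t * M) : ℝ) ≤
        changesIn F (2 ^ t * M + b) (2 ^ t * M + b + 2 * (2 ^ t * M)) :=
      mod_cast changesIn_mono F (by rw [pow_succ, mul_right_comm]; omega) (by omega)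
    have h3 := changesIn_window_le hx (m := 2 ^ t * M) (b := b) (by omega)
    have h4 := ih fun s hs => ht s (by omega)
    push_cast
    linarith

theorem degOE_le (hx : ∀ m b : ℕ, 4 * m + b ≤ n → (windowChanges F m b : ℝ) ≤ x) (hn : 9 ≤ n)
    {M t : ℕ} (ht : ∀ s < t, 4 * (2 ^ s * M) + 1 ≤ n) (hM : n ≤ 4 * (2 ^ t * M) + 4) :
    (degOE F : ℝ) ≤ 2 * M + (2 * t + 2) * (2 * x) := by
  -- The middle is covered by `[q, 3q)` and `[q + b, 3q + b)`, the extreme positions for windows of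
  -- size `q`; they overlap because `b ≤ 3` and `q ≥ 2`.
  obtain ⟨q, b, hq, hb⟩ : ∃ q b, n = 4 * q + b + 1 ∧ b < 4 :=
    ⟨(n - 1) / 4, (n - 1) % 4, by omega, by omega⟩
  have h1 : changesIn F 0 (n - 1) ≤ changesIn F 0 (2 ^ t * M) +
      (changesIn F (2 ^ t * M) (n - 1 - 2 ^ t * M) + changesIn F (n - 1 - 2 ^ t * M) (n - 1)) :=
    (changesIn_le_add F 0 (2 ^ t * M) (n - 1)).trans
      (Nat.add_le_add_left (changesIn_le_add F _ _ _) _)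
  have h2 : changesIn F (2 ^ t * M) (n - 1 - 2 ^ t * M) ≤
      changesIn F (q + 0) (q + 0 + 2 * q) + changesIn F (q + b) (q + b + 2 * q) :=
    (changesIn_le_add F _ (q + 0 + 2 * q) _).trans (Nat.add_le_add
      (changesIn_mono F (by omega) le_rfl) (changesIn_mono F (by omega) (by omega)))
  have h3 := changesIn_window_le hx (m := q) (b := 0) (by omega)
  have h3' := changesIn_window_le hx (m := q) (b := b) (by omega)
  have h4 := changesIn_left_le hx M t ht
  have h5 := changesIn_right_le hx M t ht
  rw [← degOE_eq_changesIn] at h1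
  have h1' : (degOE F : ℝ) ≤ _ := Nat.cast_le.2 h1
  have h2' : (changesIn F (2 ^ t * M) (n - 1 - 2 ^ t * M) : ℝ) ≤ _ := Nat.cast_le.2 h2
  push_cast at h1' h2'
  linarith

/-- If every window were poor, the cover would count too few changes: with `M` about `k/4` the two
ends cost at most `k/2`, and the `2t + 2` ranges, where `t ≤ 3L`, cost at most `2k/5`. -/
theorem exists_window (F : Cube n → ℤˣ) (hk : 16 ≤ degOE F) : ∃ m b : ℕ, 4 * m + b ≤ n ∧
    1 / 40 * (degOE F : ℝ) / max 1 (Real.logb 2 ((n : ℝ) / degOE F)) ≤ windowChanges F m b := by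
  set k := degOE F with hkdef
  set L := max 1 (Real.logb 2 ((n : ℝ) / k))
  by_contra! hcon
  have hx : ∀ m b : ℕ, 4 * m + b ≤ n → (windowChanges F m b : ℝ) ≤ 1 / 40 * k / L :=
    fun m b h => (hcon m b h).le
  have hkn : k ≤ n - 1 := by
    have := changesIn_le F 0 (n - 1)
    rwa [← degOE_eq_changesIn] at this
  obtain ⟨M, hM⟩ : ∃ M, M = k / 4 := ⟨_, rfl⟩
  have hex : ∃ t, n ≤ 4 * (2 ^ t * M) + 4 := by
    refine ⟨n, ?_⟩
    have h1 := Nat.lt_two_pow_self (n := n)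
    have h2 := Nat.le_mul_of_pos_right (2 ^ n) (show 0 < M by omega)
    omega
  classical
  obtain ⟨t, htdef⟩ : ∃ t, t = Nat.find hex := ⟨_, rfl⟩
  have ht1 : n ≤ 4 * (2 ^ t * M) + 4 := htdef ▸ Nat.find_spec hex
  have ht2 : ∀ s < t, 4 * (2 ^ s * M) + 1 ≤ n := fun s hs => by
    have := Nat.find_min hex (htdef ▸ hs)
    omega
  have hdeg := degOE_le hx (by omega) ht2 ht1
  rw [← hkdef] at hdeg
  have hL : 1 ≤ L := le_max_left _ _
  have hk0 : (16 : ℝ) ≤ k := mod_cast hk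
  have htL : (t : ℝ) ≤ 3 * L := by
    rcases Nat.eq_zero_or_pos t with h0 | h0
    · rw [h0, Nat.cast_zero]
      linarith
    obtain ⟨s, rfl⟩ := Nat.exists_eq_add_of_lt h0
    have hs := ht2 s (by omega)
    -- Minimality of `t` gives `4 * 2^(t-1) * M < n`, and `k ≤ 5M` since `k ≥ 16`; hence `t - 2 ≤
    -- log (n/k)`.
    have hpow : 2 ^ (0 + s + 1) * k ≤ 4 * n := by
      rw [zero_add, pow_succ]
      have : k ≤ 5 * M := by omega
      have := Nat.mul_le_mul_left (2 ^ s) this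
      rw [mul_right_comm]
      rw [mul_left_comm] at this
      omega
    have hle : (2 : ℝ) ^ ((0 + s + 1 : ℕ) - 2 : ℝ) ≤ (n : ℝ) / k := by
      rw [Real.rpow_sub (by norm_num), Real.rpow_natCast, div_le_div_iff₀ (by norm_num) (by linarith)]
      norm_num
      rw [mul_comm (n : ℝ)]
      have h' : ((2 ^ (0 + s + 1) * k : ℕ) : ℝ) ≤ (4 * n : ℕ) := Nat.cast_le.2 hpow
      push_cast at h'
      simpa using h'
    have hpos : (0 : ℝ) < (n : ℝ) / k := lt_of_lt_of_le (by positivity) hle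
    have := (Real.le_logb_iff_rpow_le (by norm_num) hpos).2 hle
    have := this.trans (le_max_right 1 _)
    change _ ≤ L at this
    linarith
  have hMk : 2 * (M : ℝ) ≤ k / 2 := by
    have : 4 * M ≤ k := by omega
    have : 4 * (M : ℝ) ≤ k := mod_cast this
    linarith
  have hy : 0 ≤ 2 * (1 / 40 * (k : ℝ) / L) := by positivity
  have h6 : (2 * (t : ℝ) + 2) * (2 * (1 / 40 * k / L)) ≤ 8 * L * (2 * (1 / 40 * k / L)) :=
    mul_le_mul_of_nonneg_right (by linarith) hy
  have h7 : 8 * L * (2 * (1 / 40 * k / L)) = 2 / 5 * k := by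
    field_simp
    norm_num
  linarith

end Cover

/-! ### The bounds on signed monomial complexity and margin. -/

theorem exists_signRepresents {n : ℕ} (F : Cube n → ℤˣ) :
    ∃ p : MLPoly n, (∀ x, p.eval x = ((F x : ℤ) : ℝ)) ∧ SignRepresents p F := by
  obtain ⟨p, hp⟩ := exists_eval_eq fun x => ((F x : ℤ) : ℝ)
  exact ⟨p, hp, fun x => by rw [hp, units_mul_self]; norm_num⟩

theorem IsSymm.rpow_le_signMon {n : ℕ} {F : Cube n → ℤˣ} (hF : IsSymm F) (hk : 16 ≤ degOE F) :
    (2 : ℝ) ^ (1 / 40 * (degOE F : ℝ) / max 1 (Real.logb 2 ((n : ℝ) / degOE F))) ≤ signMon F := by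
  obtain ⟨m, b, hmb, hd⟩ := exists_window F hk
  obtain ⟨p₀, _, hp₀⟩ := exists_signRepresents F
  obtain ⟨p, hp, hpm⟩ := Nat.sInf_mem
    (s := {m : ℕ | ∃ p : MLPoly n, SignRepresents p F ∧ p.numMonomials = m}) ⟨_, p₀, hp₀, rfl⟩
  have h := hF.two_pow_windowChanges_le_numMonomials (m := m) (b := b) (c := n - (4 * m + b)) (by omega) hp
  rw [hpm] at h
  calc _ ≤ (2 : ℝ) ^ (windowChanges F m b : ℝ) :=
        Real.rpow_le_rpow_of_exponent_le (by norm_num) hd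
    _ ≤ _ := by
        rw [Real.rpow_natCast]
        exact_mod_cast h

theorem IsSymm.margin_le {n : ℕ} {F : Cube n → ℤˣ} (hF : IsSymm F) (hk : 16 ≤ degOE F) :
    margin F ≤
      1 / (2 : ℝ) ^ (1 / 40 * (degOE F : ℝ) / max 1 (Real.logb 2 ((n : ℝ) / degOE F))) := by
  obtain ⟨m, b, hmb, hd⟩ := exists_window F hk
  refine Real.sSup_le ?_ (by positivity)
  rintro δ ⟨p, hp, -, rfl⟩
  refine (hF.le_of_forall_le_eval (m := m) (b := b) (c := n - (4 * m + b)) (by omega) hp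
    fun x => ciInf_le (Set.finite_range _).bddBelow x).trans ?_
  rw [← Real.rpow_natCast]
  exact one_div_le_one_div_of_le (by positivity)
    (Real.rpow_le_rpow_of_exponent_le (by norm_num) hd)

/-! ### Distance products for nodes placed symmetrically about `j + 1/2`. -/

section Nodes

/-- The product of the distances from a node to the others, for the nodes
`j + 1 + h l` and `j - h l`, `0 ≤ l ≤ K`. -/
def nodeProd (h : ℕ → ℕ) (K k : ℕ) : ℝ :=
  ∏ l ∈ Finset.range (K + 1),
    (if l = k then 1 else |(h l : ℝ) - h k|) * ((h l : ℝ) + h k + 1)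

/-- The nodes `j + 1 + h l` and `j - h l`, `0 ≤ l ≤ K`. -/
def nodes (h : ℕ → ℕ) (K j : ℕ) : Finset ℕ :=
  (Finset.range (K + 1)).image (fun l => j + 1 + h l) ∪
    (Finset.range (K + 1)).image (fun l => j - h l)

variable {h : ℕ → ℕ} {K j : ℕ}

theorem prod_nodes (hinj : StrictMono h) (hj : h K ≤ j) (f : ℕ → ℝ) :
    ∏ t ∈ nodes h K j, f t = ∏ l ∈ Finset.range (K + 1), f (j + 1 + h l) * f (j - h l) := by
  have hle (l : ℕ) (hl : l ∈ Finset.range (K + 1)) : h l ≤ j :=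
    (hinj.monotone (Nat.lt_succ_iff.1 (Finset.mem_range.1 hl))).trans hj
  rw [nodes, Finset.prod_union, Finset.prod_image, Finset.prod_image, Finset.prod_mul_distrib]
  · intro a ha b hb hab
    have := hle a ha
    have := hle b hb
    exact hinj.injective (by simp only at hab; omega)
  · intro a _ b _ hab
    exact hinj.injective (by simp only at hab; omega)
  · rw [Finset.disjoint_left]
    intro a ha hb
    obtain ⟨l, -, rfl⟩ := Finset.mem_image.1 ha
    obtain ⟨l', -, h'⟩ := Finset.mem_image.1 hb
    omega

theorem sum_nodes (hinj : StrictMono h) (hj : h K ≤ j) (f : ℕ → ℝ) :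
    ∑ t ∈ nodes h K j, f t = ∑ l ∈ Finset.range (K + 1), (f (j + 1 + h l) + f (j - h l)) := by
  have hle (l : ℕ) (hl : l ∈ Finset.range (K + 1)) : h l ≤ j :=
    (hinj.monotone (Nat.lt_succ_iff.1 (Finset.mem_range.1 hl))).trans hj
  rw [nodes, Finset.sum_union, Finset.sum_image, Finset.sum_image, Finset.sum_add_distrib]
  · intro a ha b hb hab
    have := hle a ha
    have := hle b hb
    exact hinj.injective (by simp only at hab; omega)
  · intro a _ b _ hab
    exact hinj.injective (by simp only at hab; omega)
  · rw [Finset.disjoint_left]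
    intro a ha hb
    obtain ⟨l, -, rfl⟩ := Finset.mem_image.1 ha
    obtain ⟨l', -, h'⟩ := Finset.mem_image.1 hb
    omega

theorem card_nodes (hinj : StrictMono h) (hj : h K ≤ j) : (nodes h K j).card = 2 * K + 2 := by
  have := sum_nodes hinj hj fun _ => 1
  simp only [Finset.sum_const, nsmul_eq_mul, mul_one, Finset.card_range] at this
  have h' : ((nodes h K j).card : ℝ) = (2 * K + 2 : ℕ) := by
    rw [this]
    push_cast
    ring
  exact_mod_cast h'

theorem right_mem_nodes {k : ℕ} (hk : k ∈ Finset.range (K + 1)) : j + 1 + h k ∈ nodes h K j :=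
  Finset.mem_union_left _ (Finset.mem_image_of_mem (fun l => j + 1 + h l) hk)

theorem left_mem_nodes {k : ℕ} (hk : k ∈ Finset.range (K + 1)) : j - h k ∈ nodes h K j :=
  Finset.mem_union_right _ (Finset.mem_image_of_mem (fun l => j - h l) hk)

theorem prod_erase_eq_ite {s : Finset ℕ} {x : ℕ} (f : ℕ → ℝ) :
    ∏ t ∈ s.erase x, f t = ∏ t ∈ s, if t = x then 1 else f t := by
  rw [← Finset.filter_ne', Finset.prod_filter]
  exact Finset.prod_congr rfl fun t _ => by by_cases h : t = x <;> simp [h]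

theorem prod_erase_right_node (hinj : StrictMono h) (hj : h K ≤ j) {k : ℕ} :
    ∏ t ∈ (nodes h K j).erase (j + 1 + h k), |(t : ℝ) - (j + 1 + h k : ℕ)| = nodeProd h K k := by
  rw [prod_erase_eq_ite, prod_nodes hinj hj, nodeProd]
  refine Finset.prod_congr rfl fun l hl => ?_
  have hle : h l ≤ j := (hinj.monotone (Nat.lt_succ_iff.1 (Finset.mem_range.1 hl))).trans hj
  rw [if_neg (show j - h l ≠ j + 1 + h k by omega)]
  congr 1
  · by_cases hlk : l = k
    · simp [hlk]
    · rw [if_neg hlk, if_neg fun h' => hlk (hinj.injective (by omega))]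
      push_cast
      congr 1
      ring
  · rw [Nat.cast_sub hle, abs_sub_comm]
    push_cast
    rw [show (j : ℝ) + 1 + h k - (j - h l) = h l + h k + 1 by ring]
    exact abs_of_nonneg (by positivity)

theorem prod_erase_left_node (hinj : StrictMono h) (hj : h K ≤ j) {k : ℕ} (hk : h k ≤ j) :
    ∏ t ∈ (nodes h K j).erase (j - h k), |(t : ℝ) - (j - h k : ℕ)| = nodeProd h K k := by
  rw [prod_erase_eq_ite, prod_nodes hinj hj, nodeProd]
  refine Finset.prod_congr rfl fun l hl => ?_
  have hle : h l ≤ j := (hinj.monotone (Nat.lt_succ_iff.1 (Finset.mem_range.1 hl))).trans hj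
  rw [if_neg (show j + 1 + h l ≠ j - h k by omega), mul_comm]
  congr 1
  · by_cases hlk : l = k
    · simp [hlk]
    · rw [if_neg hlk, if_neg fun h' => hlk (hinj.injective (by omega)), Nat.cast_sub hle,
        Nat.cast_sub hk, abs_sub_comm]
      congr 1
      ring
  · rw [Nat.cast_sub hk]
    push_cast
    rw [show (j : ℝ) + 1 + h l - (j - h k) = h l + h k + 1 by ring]
    exact abs_of_nonneg (by positivity)

theorem nodeProd_pos (hinj : StrictMono h) (k : ℕ) : 0 < nodeProd h K k := by
  refine Finset.prod_pos fun l _ => mul_pos ?_ (by positivity)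
  split_ifs with hlk
  · exact one_pos
  · rw [abs_pos, sub_ne_zero, Ne, Nat.cast_inj]
    exact fun h' => hlk (hinj.injective h')

end Nodes

/-! ### Concentration of the dual mass on the two central nodes. -/

section Estimate

/-- Only the weaker constant `2` in place of `4(N+1)/(2N+1)` is needed later; the sharper factor
makes the induction close. -/
theorem four_mul_prod_odd_le (N : ℕ) :
    4 * ((N : ℝ) + 1) * ∏ l ∈ Finset.range (N + 1), ((2 * (l : ℝ) + 1) / 2) ^ 2 ≤
      (2 * N + 1) * (N.factorial * (N + 1).factorial) := by
  induction N with
  | zero => norm_num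
  | succ N ih =>
    rw [Finset.prod_range_succ]
    set P := ∏ l ∈ Finset.range (N + 1), ((2 * (l : ℝ) + 1) / 2) ^ 2
    rw [Nat.factorial_succ (N + 1), Nat.factorial_succ N] at *
    push_cast at *
    set Q : ℝ := (N.factorial : ℝ)
    have hQ : 0 ≤ Q ^ 2 := sq_nonneg Q
    have hN : (0 : ℝ) ≤ N := Nat.cast_nonneg N
    have h1 : 4 * P ≤ (2 * N + 1) * Q ^ 2 := by
      refine le_of_mul_le_mul_left ?_ (show (0 : ℝ) < N + 1 by positivity)
      linarith
    have h2 : (N + 2) * ((2 * ((N : ℝ) + 1) + 1) / 2) ^ 2 * (4 * P) ≤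
        (N + 2) * ((2 * ((N : ℝ) + 1) + 1) / 2) ^ 2 * ((2 * N + 1) * Q ^ 2) :=
      mul_le_mul_of_nonneg_left h1 (by positivity)
    have h3 : ((2 * ((N : ℝ) + 1) + 1) / 2) ^ 2 * (2 * N + 1) ≤
        (2 * (N + 1) + 1) * ((N + 1) * (N + 2)) := by nlinarith
    have h4 := mul_le_mul_of_nonneg_left h3 (show 0 ≤ (N + 2) * Q ^ 2 * 1 by positivity)
    have h5 : 0 ≤ (N : ℝ) * Q ^ 2 := by positivity
    nlinarith

theorem factorial_mul_factorial_le {N k : ℕ} (hk : k ≤ N) :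
    N.factorial * (N + 1).factorial ≤ (N - k).factorial * (N + 1 + k).factorial := by
  induction k with
  | zero => simp
  | succ k ih =>
    refine (ih (by omega)).trans ?_
    obtain ⟨a, rfl⟩ := Nat.exists_eq_add_of_lt hk
    rw [show k + a + 1 - k = a + 1 by omega, show k + a + 1 - (k + 1) = a by omega,
      ← add_assoc, Nat.factorial_succ a, Nat.factorial_succ (k + a + 1 + 1 + k)]
    calc _ = (a + 1) * (a.factorial * (k + a + 1 + 1 + k).factorial) := by ring
      _ ≤ (k + a + 1 + 1 + k + 1) * (a.factorial * (k + a + 1 + 1 + k).factorial) :=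
          Nat.mul_le_mul_right _ (by omega)
      _ = _ := by ring

theorem prod_range_add_mul_factorial (N k : ℕ) :
    (∏ l ∈ Finset.range N, ((l : ℝ) + k + 1)) * k.factorial = ((N + k).factorial : ℝ) := by
  induction N with
  | zero => simp
  | succ N ih =>
    rw [Finset.prod_range_succ, mul_right_comm, ih, add_right_comm N 1 k, Nat.factorial_succ]
    push_cast
    ring

theorem prod_ite_abs_sub_mul {N k : ℕ} (hk : k ≤ N) :
    (∏ l ∈ Finset.range (N + 1), if l = k then (1 : ℝ) else |(l : ℝ) - k|) *
      ∏ l ∈ Finset.range (N + 1), ((l : ℝ) + k + 1) =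
      (N - k).factorial * (N + 1 + k).factorial := by
  rw [← prod_erase_eq_ite, prod_range_erase_abs_sub hk]
  rw [← prod_range_add_mul_factorial]
  push_cast
  ring

/-- The sequence `0, 40, 121, 202, …`. -/
def nodeSeq (k : ℕ) : ℕ := 81 * k - 41

theorem strictMono_nodeSeq : StrictMono nodeSeq :=
  strictMono_nat_of_lt_succ fun k => by unfold nodeSeq; omega

theorem cast_nodeSeq_succ (k : ℕ) : (nodeSeq (k + 1) : ℝ) = 81 * k + 40 := by
  rw [nodeSeq, show 81 * (k + 1) - 41 = 81 * k + 40 by omega]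
  push_cast
  rfl

/-- Measured from `j + 1/2`, the outer nodes are `±81(2l+1)/2`, so `u(u+1)` is at most the square of
that distance, and mutual distances of outer nodes reduce to factorials. The outer product at `k`
lacks one factor `81`, the self-distance, which gives the gain `2/81`. The spacing is odd so that
the nodes are integers, and `81` is large enough for `4/81 ≤ 1/20`. -/
theorem nodeProd_zero_le {N k : ℕ} (hk : k ≤ N) :
    nodeProd nodeSeq (N + 1) 0 ≤
      2 / (81 * (2 * k + 1) ^ 2) * nodeProd nodeSeq (N + 1) (k + 1) := by
  have hkmem : k ∈ Finset.range (N + 1) := Finset.mem_range.2 (Nat.lt_succ_of_le hk)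
  have h0 : (nodeSeq 0 : ℝ) = 0 := by simp [nodeSeq]
  set u : ℕ → ℝ := fun l => 81 * l + 40 with hu
  set G : ℝ := (N - k).factorial * (N + 1 + k).factorial with hG
  set Q : ℝ := ∏ l ∈ Finset.range (N + 1), ((2 * (l : ℝ) + 1) / 2) ^ 2 with hQdef
  have hP : nodeProd nodeSeq (N + 1) 0 = ∏ l ∈ Finset.range (N + 1), u l * (u l + 1) := by
    rw [nodeProd, Finset.prod_range_succ']
    simp only [cast_nodeSeq_succ, h0, hu]
    simp only [if_true, zero_add, add_zero, sub_zero, mul_one, Nat.add_eq_zero_iff, one_ne_zero,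
      and_false, if_false]
    refine Finset.prod_congr rfl fun l _ => ?_
    rw [abs_of_nonneg (by positivity)]
  have hZ : nodeProd nodeSeq (N + 1) (k + 1) =
      (81 ^ 2) ^ (N + 1) * (1 / 81) * G * (u k * (u k + 1)) := by
    rw [nodeProd, Finset.prod_range_succ']
    simp only [cast_nodeSeq_succ, h0]
    congr 1
    · rw [hG, ← prod_ite_abs_sub_mul hk]
      have h1 : ∏ l ∈ Finset.range (N + 1), (if l = k then (1 / 81 : ℝ) else 1) = 1 / 81 := by
        rw [Finset.prod_ite_eq' (Finset.range (N + 1)) k fun _ => (1 / 81 : ℝ), if_pos hkmem]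
      have h2 : ∏ l ∈ Finset.range (N + 1), (81 ^ 2 : ℝ) = (81 ^ 2) ^ (N + 1) := by simp
      rw [← h1, ← h2, ← Finset.prod_mul_distrib, ← Finset.prod_mul_distrib,
        ← Finset.prod_mul_distrib]
      refine Finset.prod_congr rfl fun l _ => ?_
      by_cases hlk : l = k
      · simp [hlk]
        ring
      · rw [if_neg (by omega), if_neg hlk, if_neg hlk,
          show (81 * (l : ℝ) + 40 - (81 * k + 40)) = 81 * (l - k) by ring, abs_mul]
        norm_num
        ring
    · rw [if_neg (by omega), zero_sub, abs_neg, abs_of_nonneg (by positivity)]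
      ring
  have hE : ∏ l ∈ (Finset.range (N + 1)).erase k, u l * (u l + 1) ≤
      ∏ l ∈ (Finset.range (N + 1)).erase k, 81 ^ 2 * ((2 * (l : ℝ) + 1) / 2) ^ 2 := by
    refine Finset.prod_le_prod (fun l _ => by positivity) fun l _ => ?_
    simp only [hu]
    nlinarith
  have hEQ := Finset.mul_prod_erase (Finset.range (N + 1))
    (fun l : ℕ => (81 : ℝ) ^ 2 * ((2 * (l : ℝ) + 1) / 2) ^ 2) hkmem
  rw [Finset.prod_mul_distrib (s := Finset.range (N + 1)), Finset.prod_const, Finset.card_range,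
    ← hQdef] at hEQ
  have hQ : 2 * Q ≤ G := by
    have h1 := four_mul_prod_odd_le N
    have h2 : ((N.factorial * (N + 1).factorial : ℕ) : ℝ) ≤
        ((N - k).factorial * (N + 1 + k).factorial : ℕ) :=
      Nat.cast_le.2 (factorial_mul_factorial_le hk)
    push_cast at h2
    rw [← hG] at h2
    rw [← hQdef] at h1
    have hG0 : 0 ≤ G := by positivity
    have hN : (0 : ℝ) ≤ N := Nat.cast_nonneg N
    have h3 := mul_le_mul_of_nonneg_left h2 (show (0 : ℝ) ≤ 2 * N + 1 by positivity)
    refine le_of_mul_le_mul_left ?_ (show (0 : ℝ) < 2 * (N + 1) by positivity)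
    nlinarith
  rw [hP, hZ, ← Finset.mul_prod_erase _ _ hkmem]
  set E := ∏ l ∈ (Finset.range (N + 1)).erase k, (81 : ℝ) ^ 2 * ((2 * (l : ℝ) + 1) / 2) ^ 2
  have hE' : E ≤ 2 / (81 * (2 * k + 1) ^ 2) * ((81 ^ 2) ^ (N + 1) * (1 / 81) * G) := by
    have hs : (0 : ℝ) < 81 ^ 2 * ((2 * (k : ℝ) + 1) / 2) ^ 2 := by positivity
    refine le_of_mul_le_mul_left ?_ hs
    rw [hEQ]
    have : 81 ^ 2 * ((2 * (k : ℝ) + 1) / 2) ^ 2 *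
        (2 / (81 * (2 * k + 1) ^ 2) * ((81 ^ 2) ^ (N + 1) * (1 / 81) * G)) =
        (81 ^ 2) ^ (N + 1) * (G / 2) := by
      field_simp
    rw [this]
    exact mul_le_mul_of_nonneg_left (by linarith) (by positivity)
  have huk : 0 ≤ u k * (u k + 1) := by positivity
  calc _ ≤ u k * (u k + 1) * _ := mul_le_mul_of_nonneg_left (hE.trans hE') huk
    _ = _ := by ring

theorem sum_inv_odd_sq_le (N : ℕ) :
    ∑ k ∈ Finset.range (N + 1), 1 / (2 * (k : ℝ) + 1) ^ 2 ≤ 2 - 1 / ((N : ℝ) + 1) := by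
  induction N with
  | zero => norm_num
  | succ N ih =>
    rw [Finset.sum_range_succ]
    have h1 : 1 / (2 * ((N + 1 : ℕ) : ℝ) + 1) ^ 2 ≤ 1 / (((N : ℝ) + 1) * (N + 2)) := by
      refine one_div_le_one_div_of_le (by positivity) ?_
      push_cast
      nlinarith [(Nat.cast_nonneg N : (0 : ℝ) ≤ N)]
    have h2 : 1 / (((N : ℝ) + 1) * (N + 2)) = 1 / (N + 1) - 1 / ((N + 1 : ℕ) + 1) := by
      push_cast
      field_simp
      ring
    linarith

/-- The mass away from the two central nodes is small. -/
theorem sum_inv_nodeProd_le (K : ℕ) : ∑ k ∈ Finset.range K, 1 / nodeProd nodeSeq K (k + 1) ≤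
    1 / 20 * (1 / nodeProd nodeSeq K 0) := by
  have hpos := fun k => nodeProd_pos (K := K) strictMono_nodeSeq k
  cases K with
  | zero =>
    have := hpos 0
    simp only [Finset.range_zero, Finset.sum_empty]
    positivity
  | succ N =>
    calc _ ≤ ∑ k ∈ Finset.range (N + 1),
          1 / (2 * (k : ℝ) + 1) ^ 2 * (2 / 81 * (1 / nodeProd nodeSeq (N + 1) 0)) := by
          refine Finset.sum_le_sum fun k hk => ?_
          have h := nodeProd_zero_le (Nat.lt_succ_iff.1 (Finset.mem_range.1 hk))
          have h1 := hpos (k + 1)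
          have h0 := hpos 0
          rw [div_le_iff₀ h1]
          calc (1 : ℝ) = nodeProd nodeSeq (N + 1) 0 * (1 / nodeProd nodeSeq (N + 1) 0) := by
                field_simp
            _ ≤ _ := mul_le_mul_of_nonneg_right h (by positivity)
            _ = _ := by
                field_simp
      _ ≤ (2 - 1 / ((N : ℝ) + 1)) * (2 / 81 * (1 / nodeProd nodeSeq (N + 1) 0)) := by
          rw [← Finset.sum_mul]
          have h0 := hpos 0
          exact mul_le_mul_of_nonneg_right (sum_inv_odd_sq_le N) (by positivity)
      _ ≤ _ := by
          have h0 := hpos 0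
          have h2 : 0 ≤ 1 / nodeProd nodeSeq (N + 1) 0 := by positivity
          have h3 : 0 ≤ 1 / ((N : ℝ) + 1) := by positivity
          nlinarith

end Estimate
-- Approximate weight from a single central change.
theorem units_eq_neg_of_ne {a b : ℤˣ} (h : a ≠ b) : b = -a := by
  rcases Int.units_eq_one_or a with h1 | h1 <;> rcases Int.units_eq_one_or b with h2 | h2 <;>
    rw [h1, h2] at h ⊢ <;> first | exact absurd rfl h | simp

/-- A symmetric function whose sign changes between the levels `j` and `j + 1`, far from both ends,
correlates well with a function that is orthogonal to all polynomials of low degree. -/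
theorem exists_pureHighDegree_correlated {m j K : ℕ} (hj : nodeSeq K ≤ j)
    (hm : j + 1 + nodeSeq K ≤ m) (g : ℕ → ℤˣ) (hg : g j ≠ g (j + 1)) :
    ∃ φ : Cube m → ℝ, PureHighDegree φ (2 * K + 1) ∧ 0 < ∑ w, |φ w| ∧
      19 / 21 * ∑ w, |φ w| ≤ ∑ w, φ w * ((g (hammingWt w) : ℤ) : ℝ) := by
  have hmono := strictMono_nodeSeq
  have h00 : nodeSeq 0 = 0 := rfl
  set T := nodes nodeSeq K j with hTdef
  have hle {k : ℕ} (hk : k ∈ Finset.range (K + 1)) : nodeSeq k ≤ nodeSeq K :=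
    hmono.monotone (Nat.lt_succ_iff.1 (Finset.mem_range.1 hk))
  have hT : T ⊆ Finset.range (m + 1) := by
    intro t ht
    rw [Finset.mem_range]
    rcases Finset.mem_union.1 ht with h | h <;> obtain ⟨k, hk, rfl⟩ := Finset.mem_image.1 h <;>
      have := hle hk <;> omega
  have hphd := pureHighDegree_levelDual (d := 2 * K + 1) hT
    (by rw [hTdef, card_nodes hmono hj]; omega)
  have h0 : (0 : ℕ) ∈ Finset.range (K + 1) := by simp
  have hjT : j ∈ T := left_mem_nodes h0
  have hj1T : j + 1 ∈ T := right_mem_nodes h0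
  obtain ⟨s₀, hs₀, hs1, hs2⟩ : ∃ s₀ : ℝ, |s₀| = 1 ∧ 0 < s₀ * levelDual m T j ∧
      s₀ * levelDual m T (j + 1) < 0 := by
    refine ⟨(-1) ^ (T.filter (· < j)).card, by simp, levelDual_sign hT hjT, ?_⟩
    have h1 := levelDual_sign hT hj1T
    have h2 : T.filter (· < j + 1) = insert j (T.filter (· < j)) := by
      ext t
      simp only [Finset.mem_filter, Finset.mem_insert]
      constructor
      · rintro ⟨h, h'⟩
        rcases Nat.lt_succ_iff_lt_or_eq.1 h' with h' | h'
        · exact Or.inr ⟨h, h'⟩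
        · exact Or.inl h'
      · rintro (rfl | ⟨h, h'⟩)
        · exact ⟨hjT, by omega⟩
        · exact ⟨h, by omega⟩
    rw [h2, Finset.card_insert_of_notMem (by simp), pow_succ] at h1
    linarith
  -- Both the dual function and `g` change sign from `j` to `j + 1`, so one global sign makes them
  -- agree at both central levels.
  set s : ℝ := s₀ * ((g j : ℤ) : ℝ) with hs
  have hsabs : |s| = 1 := by rw [hs, abs_mul, hs₀, abs_units, one_mul]
  set q : ℕ → ℝ := fun t => m.choose t * (s * levelDual m T t * ((g t : ℤ) : ℝ)) with hq
  set y : ℕ → ℝ := fun t => m.choose t * |levelDual m T t| with hy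
  have hqy (t : ℕ) : |q t| = y t := by
    simp only [hq, hy, abs_mul, hsabs, abs_units, Nat.abs_cast, one_mul, mul_one]
  have hsumq : ∑ w : Cube m, s * levelDual m T (hammingWt w) * ((g (hammingWt w) : ℤ) : ℝ) =
      ∑ t ∈ T, q t := by
    rw [sum_hammingWt fun t => s * levelDual m T t * ((g t : ℤ) : ℝ)]
    refine (Finset.sum_subset hT fun t ht htT => ?_).symm
    rw [levelDual_eq_zero (Nat.lt_succ_iff.1 (Finset.mem_range.1 ht)) htT]
    simp
  have hsumy : ∑ w : Cube m, |s * levelDual m T (hammingWt w)| = ∑ t ∈ T, y t := by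
    simp_rw [abs_mul, hsabs, one_mul]
    rw [sum_hammingWt fun t => |levelDual m T t|]
    refine (Finset.sum_subset hT fun t ht htT => ?_).symm
    rw [levelDual_eq_zero (Nat.lt_succ_iff.1 (Finset.mem_range.1 ht)) htT]
    simp
  have hyr {k : ℕ} (hk : k ∈ Finset.range (K + 1)) :
      y (j + 1 + nodeSeq k) = m.factorial * (1 / nodeProd nodeSeq K k) := by
    have := choose_mul_abs_levelDual hT (right_mem_nodes (j := j) hk)
    rw [prod_erase_right_node hmono hj] at this
    rw [mul_one_div, eq_div_iff (nodeProd_pos hmono k).ne', this]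
  have hyl {k : ℕ} (hk : k ∈ Finset.range (K + 1)) :
      y (j - nodeSeq k) = m.factorial * (1 / nodeProd nodeSeq K k) := by
    have := choose_mul_abs_levelDual hT (left_mem_nodes (j := j) hk)
    rw [prod_erase_left_node hmono hj ((hle hk).trans hj)] at this
    rw [mul_one_div, eq_div_iff (nodeProd_pos hmono k).ne', this]
  have hqj : q j = y j := by
    have h1 : s * levelDual m T j * ((g j : ℤ) : ℝ) = s₀ * levelDual m T j := by
      rw [hs]
      linear_combination s₀ * levelDual m T j * units_mul_self (g j)
    rw [← hqy, abs_of_nonneg]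
    simp only [hq]
    rw [h1]
    exact mul_nonneg (Nat.cast_nonneg _) hs1.le
  have hqj1 : q (j + 1) = y (j + 1) := by
    have h1 : s * levelDual m T (j + 1) * ((g (j + 1) : ℤ) : ℝ) = -(s₀ * levelDual m T (j + 1)) := by
      rw [hs, units_eq_neg_of_ne hg]
      push_cast
      linear_combination -s₀ * levelDual m T (j + 1) * units_mul_self (g j)
    rw [← hqy, abs_of_nonneg]
    simp only [hq]
    rw [h1]
    exact mul_nonneg (Nat.cast_nonneg _) (by linarith)
  set A : ℝ := m.factorial * (1 / nodeProd nodeSeq K 0)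
  set R : ℝ := ∑ k ∈ Finset.range K, m.factorial * (1 / nodeProd nodeSeq K (k + 1)) with hR
  have hA : 0 < A := by
    have := nodeProd_pos (K := K) hmono 0
    have := Nat.factorial_pos m
    positivity
  have hRA : R ≤ 1 / 20 * A := by
    rw [hR, ← Finset.mul_sum]
    have := mul_le_mul_of_nonneg_left (sum_inv_nodeProd_le K) (Nat.cast_nonneg (α := ℝ) m.factorial)
    linarith
  have hyj : y j = A := hyl h0
  have hyj1 : y (j + 1) = A := hyr h0
  have hsucc {k : ℕ} (hk : k ∈ Finset.range K) : k + 1 ∈ Finset.range (K + 1) := by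
    have := Finset.mem_range.1 hk
    simpa using this
  have hY : ∑ t ∈ T, y t = 2 * R + 2 * A := by
    rw [hTdef, sum_nodes hmono hj, Finset.sum_range_succ', h00, Nat.sub_zero, add_zero, hyj, hyj1, hR,
      Finset.mul_sum, ← two_mul]
    congr 1
    refine Finset.sum_congr rfl fun k hk => ?_
    rw [hyr (hsucc hk), hyl (hsucc hk), two_mul]
  -- The outer nodes may all disagree with `g`. As `R ≤ A/20`, the correlation ratio is still at
  -- least `(1 - 1/20)/(1 + 1/20) = 19/21`.
  have hQ : 2 * A - 2 * R ≤ ∑ t ∈ T, q t := by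
    rw [hTdef, sum_nodes hmono hj, Finset.sum_range_succ', h00, Nat.sub_zero, add_zero, hqj, hqj1, hyj,
      hyj1, hR, Finset.mul_sum, ← two_mul, sub_eq_neg_add, ← Finset.sum_neg_distrib]
    gcongr with k hk
    have h1 := neg_abs_le (q (j + 1 + nodeSeq (k + 1)))
    have h2 := neg_abs_le (q (j - nodeSeq (k + 1)))
    rw [hqy, hyr (hsucc hk)] at h1
    rw [hqy, hyl (hsucc hk)] at h2
    linarith
  have hR0 : 0 ≤ R := Finset.sum_nonneg fun k _ => by
    have := nodeProd_pos (K := K) hmono (k + 1)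
    positivity
  refine ⟨fun w => s * levelDual m T (hammingWt w), fun B hB => ?_, ?_, ?_⟩
  · rw [← mul_zero s, ← hphd B hB, Finset.mul_sum]
    exact Finset.sum_congr rfl fun w _ => by ring
  · rw [hsumy, hY]
    linarith
  · rw [hsumy, hsumq, hY]
    linarith

theorem IsSymm.le_wt {n m b c j K : ℕ} {F : Cube n → ℤˣ} (hF : IsSymm F) (h : 4 * m + b + c = n)
    (hj : nodeSeq K ≤ j) (hm : j + 1 + nodeSeq K ≤ m)
    (hne : predicate F (m + b + 2 * j) ≠ predicate F (m + b + 2 * (j + 1))) {p : MLPoly n}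
    (hp : ∀ x, |p.eval x - ((F x : ℤ) : ℝ)| < 1 / 3) : 8 / 7 * 4 ^ K ≤ p.wt := by
  obtain ⟨e⟩ := nonempty_equiv_blocks h
  obtain ⟨φ, hφ, hpos, hcor⟩ :=
    exists_pureHighDegree_correlated hj hm (fun t => predicate F (m + b + 2 * t)) hne
  have hle := hφ.abs_sum_liftSum_eval_le e p
  -- The approximation error costs `1/3` of the mass of `φ`, and `19/21 - 1/3 = 4/7`.
  have hlow : 4 / 7 * (2 ^ m * (2 ^ m * ∑ w, |φ w|)) ≤ ∑ z, liftSum e φ z p.eval := by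
    calc _ = ∑ z : Fin m → Bool, ∑ v : Cube m, 4 / 7 * ∑ w, |φ w| := by
          simp only [Finset.sum_const, Finset.card_univ, Fintype.card_fun,
            Fintype.card_bool, Fintype.card_fin, Fintype.card_units_int, nsmul_eq_mul]
          push_cast
          ring
      _ ≤ _ := by
          refine Finset.sum_le_sum fun z _ => Finset.sum_le_sum fun v _ => ?_
          calc 4 / 7 * ∑ w, |φ w| ≤
                ∑ w, φ w * ((predicate F (m + b + 2 * hammingWt w) : ℤ) : ℝ) -
                  1 / 3 * ∑ w, |φ w| := by linarith
            _ ≤ _ := by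
              rw [Finset.mul_sum, ← Finset.sum_sub_distrib]
              refine Finset.sum_le_sum fun w _ => ?_
              have h1 := (hp (liftPoint e z v w)).le
              rw [hF.apply_liftPoint] at h1
              have h2 := mul_le_mul_of_nonneg_left h1 (abs_nonneg (φ w))
              rw [← abs_mul] at h2
              have h3 := neg_abs_le (φ w * (p.eval (liftPoint e z v w) -
                ((predicate F (m + b + 2 * hammingWt w) : ℤ) : ℝ)))
              linarith
  have hK : 0 < 2 ^ m * (2 ^ m * ∑ w, |φ w|) := by positivity
  have h2 : (0 : ℝ) < 2 ^ (2 * K + 1) := by positivity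
  have h3 := mul_le_mul_of_nonneg_right (hlow.trans (le_abs_self _)) h2.le
  refine le_of_mul_le_mul_right ?_ hK
  calc _ = 4 / 7 * (2 ^ m * (2 ^ m * ∑ w, |φ w|)) * 2 ^ (2 * K + 1) := by
        rw [pow_succ, pow_mul]
        norm_num
        ring
    _ ≤ _ := h3.trans hle

/-- Otherwise `r₀ = r₁ = rParam F - 1` would be admissible, against minimality. -/
theorem exists_change_of_rParam {n : ℕ} {F : Cube n → ℤˣ} (hr : 1 ≤ rParam F) :
    ∃ i, rParam F ≤ i + 1 ∧ i + rParam F ≤ n ∧ i + 2 ≤ n ∧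
      predicate F i ≠ predicate F (i + 2) := by
  have hne : {r : ℕ | ∃ r₀ r₁ : ℕ, r₀ ≤ (n + 1) / 2 ∧ r₁ ≤ (n + 1) / 2 ∧ StableOn F r₀ r₁ ∧
      r = max r₀ r₁}.Nonempty :=
    Nat.nonempty_of_pos_sInf (show 0 < rParam F by omega)
  obtain ⟨r₀, r₁, h₀, h₁, -, hmax⟩ := Nat.sInf_mem hne
  change rParam F = _ at hmax
  by_contra! hcon
  have : rParam F ≤ rParam F - 1 := by
    refine Nat.sInf_le ⟨rParam F - 1, rParam F - 1, by omega, by omega, ?_, by simp⟩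
    intro i hi hi' hi''
    exact hcon i (by omega) (by omega) hi''
  omega

theorem IsSymm.rParam_le_logb_approxWt {n : ℕ} {F : Cube n → ℤˣ} (hF : IsSymm F)
    (hr : 5 ≤ rParam F) : 1 / 2000 * (rParam F : ℝ) ≤ Real.logb 2 (approxWt (1 / 3) F) := by
  obtain ⟨i, hi1, hi2, hi3, hne⟩ := exists_change_of_rParam (F := F) (by omega)
  -- With `m = 2j + 1` the change at `i = m + b + 2j` lies between the middle levels `j` and `j +
  -- 1`. The window fits because `4j + 1 ≤ i` and `i + 4j + 3 ≤ n`; `K` is the largest index with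
  -- `nodeSeq K ≤ j`.
  obtain ⟨j, hj⟩ : ∃ j, j = (rParam F - 3) / 4 := ⟨_, rfl⟩
  obtain ⟨K, hK⟩ : ∃ K, K = (j + 41) / 81 := ⟨_, rfl⟩
  obtain ⟨b, rfl⟩ : ∃ b, i = 4 * j + 1 + b := Nat.exists_eq_add_of_le (by omega)
  obtain ⟨c, hc⟩ : ∃ c, n = 4 * (2 * j + 1) + b + c := Nat.exists_eq_add_of_le (by omega)
  have hnode : nodeSeq K ≤ j := by
    unfold nodeSeq
    omega
  have hwt : 8 / 7 * 4 ^ K ≤ approxWt (1 / 3) F := by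
    obtain ⟨p₀, hp₀, -⟩ := exists_signRepresents F
    refine le_csInf ⟨_, p₀, fun x => by rw [hp₀]; norm_num, rfl⟩ ?_
    rintro w ⟨p, hp, rfl⟩
    refine hF.le_wt (m := 2 * j + 1) (b := b) (c := c) hc.symm hnode (by omega) ?_ hp
    convert hne using 2 <;> ring
  have hrK : (rParam F : ℝ) ≤ 324 * K + 162 := by
    have : rParam F ≤ 324 * K + 162 := by omega
    exact_mod_cast this
  -- For `K = 0` the factor `8/7 > 1` alone keeps the logarithm positive; it must absorb `162/2000`.
  have h87 : (2 : ℝ) ^ (1 / 6 : ℝ) ≤ 8 / 7 := by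
    rw [one_div, Real.rpow_inv_le_iff_of_pos (by norm_num) (by norm_num) (by norm_num)]
    norm_num
  refine (Real.le_logb_iff_rpow_le (by norm_num) (lt_of_lt_of_le (by positivity) hwt)).2 ?_
  calc (2 : ℝ) ^ (1 / 2000 * (rParam F : ℝ)) ≤ 2 ^ (1 / 6 + 2 * (K : ℝ)) :=
        Real.rpow_le_rpow_of_exponent_le (by norm_num) (by
          have : (0 : ℝ) ≤ K := Nat.cast_nonneg K
          linarith)
    _ = 2 ^ (1 / 6 : ℝ) * 4 ^ K := by
        rw [Real.rpow_add (by norm_num), Real.rpow_mul (by norm_num), Real.rpow_natCast]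
        norm_num
    _ ≤ 8 / 7 * 4 ^ K := mul_le_mul_of_nonneg_right h87 (by positivity)
    _ ≤ _ := hwt

end BoolCube

open BoolCube

theorem mainTheorem5 :
    (∃ c₁ : ℝ, 0 < c₁ ∧ ∀ (n : ℕ) (F : Cube n → ℤˣ), IsSymm F → 5 ≤ rParam F →
      c₁ * (rParam F : ℝ) ≤ Real.logb 2 (approxWt (1 / 3) F)) ∧
    (∃ c₂ : ℝ, 0 < c₂ ∧ ∀ (n : ℕ) (F : Cube n → ℤˣ), IsSymm F → 16 ≤ degOE F →
      (2 : ℝ) ^ (c₂ * (degOE F : ℝ) / max 1 (Real.logb 2 ((n : ℝ) / (degOE F : ℝ)))) ≤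
        (signMon F : ℝ)) ∧
    (∃ c₃ : ℝ, 0 < c₃ ∧ ∀ (n : ℕ) (F : Cube n → ℤˣ), IsSymm F → 16 ≤ degOE F →
      margin F ≤
        1 / (2 : ℝ) ^ (c₃ * (degOE F : ℝ) / max 1 (Real.logb 2 ((n : ℝ) / (degOE F : ℝ))))) :=
  ⟨⟨1 / 2000, by norm_num, fun _ _ hF hr => hF.rParam_le_logb_approxWt hr⟩,
    ⟨1 / 40, by norm_num, fun _ _ hF hk => hF.rpow_le_signMon hk⟩,
    ⟨1 / 40, by norm_num, fun _ _ hF hk => hF.margin_le hk⟩⟩
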